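/- Let $d\ge 1$, let $\mathcal H_X,\mathcal H_Y$ be complex Hilbert spaces, and for $q\in[1,\infty]$ let $\ell^q(\mathbb Z^d,\mathcal H)$ be the Banach space of $q$-summable (bounded, if $q=\infty$) families in $\mathcal H$ indexed by $\mathbb Z^d$. Let $\mathbb A=(a_{mn})_{m,n\in\mathbb Z^d}$ be a matrix of bounded linear operators $a_{mn}:\mathcal H_X\to\mathcal H_Y$, acting by $(\mathbb Ax)_m=\sum_n a_{mn}x_n$, and let $\mathbb A^\star=(a_{nm}^*)_{m,n}$ be its adjoint matrix, which has entries $\mathcal H_Y\to\mathcal H_X$. For real $\alpha\ne0$ and $j\in\mathbb Z^d$ the $j$-th $\alpha$-slant $A_j$ of $\mathbb A$ is the matrix that has the entries $a_{mn}$ with $\alpha m_k-n_k\in[j_k,j_k+1)$ for all $k=1,\dots,d$, and $0$ elsewhere. For a function $\omega:\mathbb Z^d\to[1,\infty)$, $\Sigma^\omega_\alpha$ is the class of the matrices with $$\lceil|\alpha^{-1}|\rceil^d\sum_{j\in\mathbb Z^d}\Big(\sup_{m,n}\|(A_j)_{mn}\|\Big)\,\omega(j)<\infty ;$$ such a matrix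 defines a bounded operator on $\ell^q$ for every $q\in[1,\infty]$. A matrix $\mathbb B$ is called $p$-bb (bounded below in $\ell^p$) if there is $\kappa>0$ with $\|\mathbb Bx\|_p\ge\kappa\|x\|_p$ for all $x\in\ell^p$. Let $\mathbb A\in\Sigma^\omega_\alpha$, where $\alpha\neq0$, $\omega(j)=(1+|j|)^s$, $|j|=\max_k|j_k|$, and $s>(d+1)^2$, and let $p\in[1,\infty]$. (i) If $\mathbb A$ is $p$-bb, then for every $q\in[1,\infty]$ the operator $\mathbb A^\star\mathbb A$ is invertible on $\ell^q(\mathbb Z^d,\mathcal H_X)$, and $\mathbb A:\ell^q(\mathbb Z^d,\mathcal H_X)\to\ell^q(\mathbb Z^d,\mathcal H_Y)$ has the left inverse $\mathbb A^\sharp=(\mathbb A^\star\mathbb A)^{-1}\mathbb A^\star$; this operator is given by one matrix, the same for all $q$, and that matrix belongs to $\Sigma^\omega_{\alpha^{-1}}$. (ii) If $\mathbb A^\star$ is $p$-bb, then for every $q\in[1,\infty]$ the operator $\mathbb A\mathbb A^\star$ is invertible on $\ell^q(\mathbb Z^d,\mathcal H_Y)$, and $\mathbb A:\ell^q(\mathbb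 Z^d,\mathcal H_X)\to\ell^q(\mathbb Z^d,\mathcal H_Y)$ has the right inverse $\mathbb A^\flat=\mathbb A^\star(\mathbb A\mathbb A^\star)^{-1}$; this operator is given by one matrix, the same for all $q$, and that matrix belongs to $\Sigma^\omega_{\alpha^{-1}}$. -/

import Mathlib

open scoped ENNReal

noncomputable section

namespace Slanted

/-- Operator matrices `(a m n)`, `m, n ∈ ℤ^d`, whose entries are bounded linear operators
`a m n : X → Y`. -/
abbrev OpMatrix (d : ℕ) (X Y : Type*) [NormedAddCommGroup X] [NormedSpace ℂ X]
    [NormedAddCommGroup Y] [NormedSpace ℂ Y] : Type _ :=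
  (Fin d → ℤ) → (Fin d → ℤ) → (X →L[ℂ] Y)

/-- The Banach space `ℓ^p(ℤ^d, X)`. -/
abbrev Seq (d : ℕ) (X : Type*) [NormedAddCommGroup X] (p : ℝ≥0∞) : Type _ :=
  lp (fun _ : Fin d → ℤ => X) p

section Banach

variable {d : ℕ} {X Y : Type*} [NormedAddCommGroup X] [NormedSpace ℂ X]
  [NormedAddCommGroup Y] [NormedSpace ℂ Y]

/-- `sup_{m,n} ‖a m n‖`, as an extended nonnegative real. -/
def supNorm (a : OpMatrix d X Y) : ℝ≥0∞ :=
  ⨆ (m : Fin d → ℤ) (n : Fin d → ℤ), ENNReal.ofReal ‖a m n‖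

open Classical in
/-- The `j`-th `α`-slant of a matrix: the entries with `α m_k - n_k ∈ [j_k, j_k + 1)` for all `k`
are kept, and all the other entries are replaced by `0`. -/
def slant (α : ℝ) (j : Fin d → ℤ) (a : OpMatrix d X Y) : OpMatrix d X Y := fun m n =>
  if ∀ k, α * (m k : ℝ) - (n k : ℝ) ∈ Set.Ico (j k : ℝ) ((j k : ℝ) + 1) then a m n else 0

/-- The norm `K ∑_j ‖A_j‖_sup ω(j)`, `K = ⌈|α⁻¹|⌉ ^ d`, with value `∞` if the series diverges. -/
def slantNorm (α : ℝ) (ω : (Fin d → ℤ) → ℝ) (a : OpMatrix d X Y) : ℝ≥0∞ :=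
  (⌈|α⁻¹|⌉₊ : ℝ≥0∞) ^ d * ∑' j : Fin d → ℤ, supNorm (slant α j a) * ENNReal.ofReal (ω j)

/-- The class of matrices with `ω`-summable `α`-slants. -/
def SummableSlants (α : ℝ) (ω : (Fin d → ℤ) → ℝ) (a : OpMatrix d X Y) : Prop :=
  slantNorm α ω a < ∞

/-- The weight `ω(j) = (1 + |j|)^s` on `ℤ^d`, where `|j| = max_k |j_k|`. -/
def polyWeight (d : ℕ) (s : ℝ) : (Fin d → ℤ) → ℝ := fun j => (1 + ‖j‖) ^ s

/-- The bounded operator `T : ℓ^p(ℤ^d, X) → ℓ^p(ℤ^d, Y)` is the operator given by the matrix `a`: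
`(T x)_m = ∑_n a m n (x n)`, the series being unconditionally convergent. -/
def Represents {p : ℝ≥0∞} [Fact (1 ≤ p)] (a : OpMatrix d X Y)
    (T : Seq d X p →L[ℂ] Seq d Y p) : Prop :=
  ∀ (x : Seq d X p) (m : Fin d → ℤ),
    HasSum (fun n : Fin d → ℤ => a m n ((x : (Fin d → ℤ) → X) n)) ((T x : (Fin d → ℤ) → Y) m)

/-- The matrix `a` is bounded below in `ℓ^p`: the operator `T` that it defines on `ℓ^p` satisfies
`‖T x‖ ≥ κ ‖x‖` for some `κ > 0` and all `x`.
(At most one `T` is represented by `a`, and matrices with summable slants do represent one.) -/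
def IsBoundedBelow (p : ℝ≥0∞) [Fact (1 ≤ p)] (a : OpMatrix d X Y) : Prop :=
  ∃ T : Seq d X p →L[ℂ] Seq d Y p, Represents a T ∧
    ∃ κ : ℝ, 0 < κ ∧ ∀ x : Seq d X p, κ * ‖x‖ ≤ ‖T x‖

end Banach

/-- The adjoint matrix `(a⋆) m n = (a n m)*`, with the Hilbert space adjoints of the entries. -/
def adjointMatrix {d : ℕ} {X Y : Type*} [NormedAddCommGroup X] [InnerProductSpace ℂ X]
    [CompleteSpace X] [NormedAddCommGroup Y] [InnerProductSpace ℂ Y] [CompleteSpace Y]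
    (a : OpMatrix d X Y) : OpMatrix d Y X :=
  fun m n => ContinuousLinearMap.adjoint (a n m)

end Slanted

end

/-!
Write `φ m = ⌊α m⌋`, coordinatewise. The entry at `(m, n)` lies on the slant `j = φ m - n`, so that
a matrix has `ω`-summable `α`-slants if and only if `‖a m n‖ ≤ c (φ m - n)` for some `c` with
`∑ c ω < ∞` (`summableSlants_iff`). As `φ` takes each value boundedly often, such a matrix is a
norm convergent sum of weighted composition operators on every `ℓ^q` (`exists_represents`), matrix
products represent compositions (`Represents.mul`), and `A⋆ A` is dominated by a convolution
kernel `e (m - n)` with `∑ e ω < ∞` (`exists_gram_envelope`). The theorem follows from two facts.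

*Stability in `p`* (`exists_lower_bound_two`): a matrix that is bounded below in `ℓ^p` is bounded
below in `ℓ²`. Let `u` be the bump `(1 + ε |k - n|)^(-(d+1))` centred at `n`. Up to the factor `u`
itself, the commutator of `A` with multiplication by `u` is a slanted matrix of size `O(ε)` on
`ℓ^p`, uniformly in `n`, because `c` has moments of order `d + 1`. For small `ε`, fixed once and
for all, the lower bound in `ℓ^p` therefore localizes to `‖u x‖_p ≤ C ‖(u ∘ φ) A x‖_p`, whence
`‖x n‖ ≤ C ∑ m, u (φ m) ‖(A x) m‖` for every `n`. The kernel on the right is summable in each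
variable and so acts on `ℓ²`.

*Inverse-closedness* (`exists_inverse_adjoint_comp`): if `A` is bounded below in `ℓ²`, then
`C = 1 - t A⋆ A` is a strict contraction of `ℓ²` for small `t > 0`, and its Neumann series has
finite weighted norm `N`. Indeed `N (T²) ≤ 2^(s+1) N T N₀ T`, where the unweighted norm `N₀` is
bounded by the operator norm near the diagonal and by `N` far from it (`decayNorm_zero_le`). Along
the powers `T = C^(2^n)` this forces `N T < 1` for some `n`, and the series is summed along the
multiples of that exponent.

The matrix `G` of `(A⋆ A)⁻¹` on `ℓ²` is then an inverse of the matrix `A⋆ A` with summable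
envelope, so that it inverts `A⋆ A` on every `ℓ^q`; and `G A⋆` is bounded by a convolution of
envelopes. Part (ii) is the same argument for `A⋆`, whose `α⁻¹`-slants are summable
(`summableSlants_inv_of_transposed`).
-/

noncomputable section

namespace Slanted

/-! ### Slant indices, fibre bounds and polynomial weights -/

section Lattice

variable {d : ℕ}

/-- `FiberBound φ K`: the map `φ` takes every value at most `K` times. -/
def FiberBound {ι κ : Type*} (φ : ι → κ) (K : ℕ) : Prop :=
  ∀ (F : Finset ι) (n : κ), (∀ m ∈ F, φ m = n) → F.card ≤ K

theorem FiberBound.id {ι : Type*} : FiberBound (fun m : ι => m) 1 := by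
  intro F n h
  exact Finset.card_le_one.2 fun a ha b hb => (h a ha).trans (h b hb).symm

theorem FiberBound.comp_injective {ι κ μ : Type*} {φ : ι → κ} {K : ℕ} (h : FiberBound φ K)
    {g : κ → μ} (hg : Function.Injective g) : FiberBound (fun m => g (φ m)) K := by
  intro F n hF
  rcases F.eq_empty_or_nonempty with rfl | ⟨m₀, hm₀⟩
  · simp
  · exact h F (φ m₀) fun m hm => hg ((hF m hm).trans (hF m₀ hm₀).symm)

theorem FiberBound.sum_comp_le {ι κ M : Type*} [DecidableEq κ] [CommSemiring M] [PartialOrder M]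
    [IsOrderedRing M] {φ : ι → κ} {K : ℕ} (h : FiberBound φ K) {f : κ → M} (hf : ∀ n, 0 ≤ f n)
    (F : Finset ι) : ∑ m ∈ F, f (φ m) ≤ K * ∑ n ∈ F.image φ, f n := by
  rw [Finset.sum_comp f φ, Finset.mul_sum]
  refine Finset.sum_le_sum fun b _ => ?_
  rw [nsmul_eq_mul]
  refine mul_le_mul_of_nonneg_right (Nat.mono_cast ?_) (hf b)
  exact h _ b fun m hm => (Finset.mem_filter.1 hm).2

theorem FiberBound.tsum_comp_le {ι κ : Type*} {φ : ι → κ} {K : ℕ} (h : FiberBound φ K)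
    (f : κ → ℝ≥0∞) : ∑' m, f (φ m) ≤ K * ∑' n, f n := by
  classical
  rw [ENNReal.tsum_eq_iSup_sum]
  refine iSup_le fun F => (h.sum_comp_le (fun _ => zero_le) F).trans ?_
  gcongr
  exact ENNReal.sum_le_tsum _

/-- The index `⌊α m⌋`, taken coordinatewise: the entry at `(m, n)` of a matrix lies on the
`j`-th `α`-slant exactly when `⌊α m⌋ - n = j`. -/
def slantIndex (α : ℝ) (m : Fin d → ℤ) : Fin d → ℤ := fun k => ⌊α * (m k : ℝ)⌋

theorem slantIndex_sub_eq_iff (α : ℝ) (m n j : Fin d → ℤ) :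
    (∀ k, α * (m k : ℝ) - (n k : ℝ) ∈ Set.Ico (j k : ℝ) ((j k : ℝ) + 1)) ↔
      slantIndex α m - n = j := by
  rw [funext_iff]
  refine forall_congr' fun k => ?_
  rw [Set.mem_Ico, ← Int.floor_eq_iff, Int.floor_sub_intCast]
  rfl

theorem exists_fiberBound_slantIndex {α : ℝ} (hα : α ≠ 0) :
    ∃ K : ℕ, FiberBound (slantIndex (d := d) α) K := by
  obtain ⟨R, hR⟩ := exists_nat_gt |α|⁻¹
  refine ⟨(Finset.Icc (fun _ : Fin d => -(R : ℤ)) (fun _ => (R : ℤ))).card, fun F n hF => ?_⟩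
  rcases F.eq_empty_or_nonempty with rfl | ⟨m₀, hm₀⟩
  · simp
  refine Finset.card_le_card_of_injOn (fun m => m - m₀) (fun m hm => ?_)
    (fun a _ b _ h => sub_left_injective h)
  have key : ∀ k, |m k - m₀ k| ≤ (R : ℤ) := fun k => by
    have h1 : ⌊α * (m k : ℝ)⌋ = ⌊α * (m₀ k : ℝ)⌋ :=
      congrFun ((hF m hm).trans (hF m₀ hm₀).symm) k
    have h2 := Int.abs_sub_lt_one_of_floor_eq_floor h1
    rw [← mul_sub, abs_mul] at h2
    have h3 : |(m k : ℝ) - m₀ k| < |α|⁻¹ := by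
      rw [← one_div, lt_div_iff₀ (abs_pos.2 hα), mul_comm]
      exact h2
    have h4 : |(m k : ℝ) - m₀ k| ≤ R := (h3.trans hR).le
    exact_mod_cast h4
  simp only [Finset.coe_Icc, Set.mem_Icc, Pi.le_def, Pi.sub_apply]
  exact ⟨fun k => (abs_le.1 (key k)).1, fun k => (abs_le.1 (key k)).2⟩

/-- The weight `(1 + |j|)^s` with values in `[0, ∞]`. -/
def weight (s : ℝ) (j : Fin d → ℤ) : ℝ≥0∞ := ENNReal.ofReal (polyWeight d s j)

theorem weight_eq_rpow (s : ℝ) (j : Fin d → ℤ) :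
    weight s j = ENNReal.ofReal (1 + ‖j‖) ^ s := by
  rw [weight, polyWeight, ENNReal.ofReal_rpow_of_pos (by positivity)]

theorem weight_natCast (t : ℕ) (j : Fin d → ℤ) :
    weight t j = ENNReal.ofReal ((1 + ‖j‖) ^ t) := by
  rw [weight, polyWeight, Real.rpow_natCast]

@[simp] theorem weight_exponent_zero (j : Fin d → ℤ) : weight 0 j = 1 := by
  simp [weight_eq_rpow]

@[simp] theorem weight_index_zero (s : ℝ) : weight s (0 : Fin d → ℤ) = 1 := by
  simp [weight, polyWeight]

theorem one_le_ofReal_one_add_norm (j : Fin d → ℤ) : 1 ≤ ENNReal.ofReal (1 + ‖j‖) := by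
  rw [← ENNReal.ofReal_one]
  exact ENNReal.ofReal_le_ofReal (by linarith [norm_nonneg j])

theorem weight_mono_exponent {s t : ℝ} (h : s ≤ t) (j : Fin d → ℤ) : weight s j ≤ weight t j := by
  rw [weight_eq_rpow, weight_eq_rpow]
  exact ENNReal.rpow_le_rpow_of_exponent_le (one_le_ofReal_one_add_norm j) h

theorem one_le_weight {s : ℝ} (hs : 0 ≤ s) (j : Fin d → ℤ) : 1 ≤ weight s j := by
  simpa using weight_mono_exponent hs j

@[simp] theorem weight_neg (s : ℝ) (j : Fin d → ℤ) : weight s (-j) = weight s j := by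
  simp [weight_eq_rpow]

theorem weight_add_le_mul {s : ℝ} (hs : 0 ≤ s) (i j : Fin d → ℤ) :
    weight s (i + j) ≤ weight s i * weight s j := by
  simp only [weight_eq_rpow]
  rw [← ENNReal.mul_rpow_of_nonneg _ _ hs, ← ENNReal.ofReal_mul (by positivity)]
  refine ENNReal.rpow_le_rpow (ENNReal.ofReal_le_ofReal ?_) hs
  nlinarith [norm_add_le i j, mul_nonneg (norm_nonneg i) (norm_nonneg j)]

theorem weight_add_le_add {s : ℝ} (hs : 0 ≤ s) (i j : Fin d → ℤ) :
    weight s (i + j) ≤ 2 ^ s * (weight s i + weight s j) := by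
  have aux : ∀ i j : Fin d → ℤ, ‖j‖ ≤ ‖i‖ → weight s (i + j) ≤ 2 ^ s * weight s i := by
    intro i j h
    simp only [weight_eq_rpow]
    rw [← ENNReal.mul_rpow_of_nonneg _ _ hs]
    refine ENNReal.rpow_le_rpow ?_ hs
    rw [← ENNReal.ofReal_ofNat 2, ← ENNReal.ofReal_mul (by norm_num)]
    refine ENNReal.ofReal_le_ofReal ?_
    have := norm_add_le i j
    linarith
  rcases le_total ‖j‖ ‖i‖ with h | h
  · refine (aux i j h).trans ?_
    gcongr
    exact le_self_add
  · rw [add_comm i j]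
    refine (aux j i h).trans ?_
    gcongr
    exact le_add_self

/-- The weight is at most multiplied by a constant along any map that shrinks the index at most
linearly. -/
theorem exists_weight_le {s : ℝ} (hs : 0 ≤ s) {ψ : (Fin d → ℤ) → Fin d → ℤ} {L : ℝ}
    (h : ∀ i, 1 + ‖i‖ ≤ L * (1 + ‖ψ i‖)) (hL : 0 ≤ L) (i : Fin d → ℤ) :
    weight s i ≤ ENNReal.ofReal L ^ s * weight s (ψ i) := by
  simp only [weight_eq_rpow]
  rw [← ENNReal.mul_rpow_of_nonneg _ _ hs, ← ENNReal.ofReal_mul hL]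
  exact ENNReal.rpow_le_rpow (ENNReal.ofReal_le_ofReal (h i)) hs

theorem tsum_tsum_mul_sub (f g : (Fin d → ℤ) → ℝ≥0∞) :
    ∑' j, ∑' i, f i * g (j - i) = (∑' i, f i) * ∑' j, g j := by
  rw [ENNReal.tsum_comm, ← ENNReal.tsum_mul_right]
  refine tsum_congr fun i => ?_
  rw [ENNReal.tsum_mul_left]
  congr 1
  exact (Equiv.subRight i).tsum_eq g

/-- Weighted `ℓ¹` norms are submultiplicative under convolution. -/
theorem tsum_conv_mul_weight_le {s : ℝ} (hs : 0 ≤ s) (f g : (Fin d → ℤ) → ℝ≥0∞) :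
    ∑' j, (∑' i, f i * g (j - i)) * weight s j ≤
      (∑' i, f i * weight s i) * ∑' j, g j * weight s j := by
  rw [← tsum_tsum_mul_sub]
  refine ENNReal.tsum_le_tsum fun j => ?_
  rw [← ENNReal.tsum_mul_right]
  refine ENNReal.tsum_le_tsum fun i => ?_
  calc f i * g (j - i) * weight s j ≤ f i * g (j - i) * (weight s i * weight s (j - i)) := by
        gcongr
        simpa using weight_add_le_mul hs i (j - i)
    _ = _ := by ring

/-- The weighted `ℓ¹` norm of a convolution, with the weight falling on one factor at a time. -/
theorem tsum_conv_mul_weight_le_add {s : ℝ} (hs : 0 ≤ s) (f g : (Fin d → ℤ) → ℝ≥0∞) :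
    ∑' j, (∑' i, f i * g (j - i)) * weight s j ≤
      2 ^ s * ((∑' i, f i * weight s i) * (∑' j, g j) + (∑' i, f i) * ∑' j, g j * weight s j) := by
  rw [← tsum_tsum_mul_sub, ← tsum_tsum_mul_sub, ← ENNReal.tsum_add, ← ENNReal.tsum_mul_left]
  refine ENNReal.tsum_le_tsum fun j => ?_
  rw [← ENNReal.tsum_mul_right, ← ENNReal.tsum_add, ← ENNReal.tsum_mul_left]
  refine ENNReal.tsum_le_tsum fun i => ?_
  calc f i * g (j - i) * weight s j
      ≤ f i * g (j - i) * (2 ^ s * (weight s i + weight s (j - i))) := by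
        gcongr
        simpa using weight_add_le_add hs i (j - i)
    _ = _ := by ring

theorem tsum_ne_top_of_weight {s : ℝ} (hs : 0 ≤ s) {c : (Fin d → ℤ) → ℝ≥0∞}
    (hc : ∑' j, c j * weight s j ≠ ∞) : ∑' j, c j ≠ ∞ :=
  ne_top_of_le_ne_top hc (ENNReal.tsum_le_tsum fun j =>
    le_mul_of_one_le_right' (one_le_weight hs j))

theorem summable_one_add_norm_pow_inv (t : ℕ) (ht : d < t) :
    Summable fun j : Fin d → ℤ => ((1 + ‖j‖) ^ t)⁻¹ := by
  -- the norms of the integer vectors are those of the points of the standard lattice of `ℝ^d`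
  set L : Submodule ℤ (Fin d → ℝ) := Submodule.span ℤ (Set.range (Pi.basisFun ℝ (Fin d)))
  have hrank : Module.finrank ℤ L = d := by
    rw [ZLattice.rank ℝ L, Module.finrank_fin_fun]
  have hmem : ∀ j : Fin d → ℤ, (fun k => (j k : ℝ)) ∈ L := fun j => by
    rw [Module.Basis.mem_span_iff_repr_mem]
    exact fun k => ⟨j k, by simp⟩
  have hsum := ZLattice.summable_norm_pow_inv L t (by rwa [hrank])
  have hinj : Function.Injective fun j : Fin d → ℤ => (⟨fun k => (j k : ℝ), hmem j⟩ : L) := by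
    intro i j hij
    funext k
    have : (i k : ℝ) = j k := congrFun (congrArg Subtype.val hij) k
    exact_mod_cast this
  have hsum' : Summable fun j : Fin d → ℤ => ‖j‖⁻¹ ^ t := by
    refine (hsum.comp_injective hinj).congr fun j => ?_
    have : ‖(⟨fun k => (j k : ℝ), hmem j⟩ : L)‖ = ‖j‖ := by
      rw [Submodule.coe_norm]
      simp only [Pi.norm_def]
      rfl
    simp only [Function.comp, this]
  refine Summable.of_norm_bounded_eventually hsum' ?_
  filter_upwards [(Set.finite_singleton (0 : Fin d → ℤ)).compl_mem_cofinite] with j hj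
  have hj' : 0 < ‖j‖ := norm_pos_iff.2 hj
  rw [Real.norm_of_nonneg (by positivity), ← inv_pow]
  gcongr
  linarith

end Lattice

/-! ### Matrices with summable slants -/

section Envelope

variable {d : ℕ} {X Y : Type*} [NormedAddCommGroup X] [NormedSpace ℂ X]
  [NormedAddCommGroup Y] [NormedSpace ℂ Y]

/-- Membership in the class of `ω`-summable slants means that the norm of the entry at `(m, n)` is
bounded by a weighted summable function of `⌊α m⌋ - n`. -/
theorem summableSlants_iff {α : ℝ} (hα : α ≠ 0) (s : ℝ) (a : OpMatrix d X Y) :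
    SummableSlants α (polyWeight d s) a ↔
      ∃ c : (Fin d → ℤ) → ℝ≥0∞, (∀ m n, ‖a m n‖ₑ ≤ c (slantIndex α m - n)) ∧
        ∑' j, c j * weight s j ≠ ∞ := by
  unfold SummableSlants slantNorm
  constructor
  · intro h
    refine ⟨fun j => supNorm (slant α j a), fun m n => ?_, ?_⟩
    · have : slant α (slantIndex α m - n) a m n = a m n := by
        rw [slant, if_pos ((slantIndex_sub_eq_iff α m n _).2 rfl)]
      calc ‖a m n‖ₑ = ENNReal.ofReal ‖slant α (slantIndex α m - n) a m n‖ := by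
            rw [this, ofReal_norm]
        _ ≤ _ := le_iSup₂ (f := fun m' n' =>
            ENNReal.ofReal ‖slant α (slantIndex α m - n) a m' n'‖) m n
    · refine ne_top_of_le_ne_top h.ne (le_mul_of_one_le_left' (one_le_pow₀ ?_))
      have : 1 ≤ ⌈|α⁻¹|⌉₊ := Nat.one_le_ceil_iff.2 (by positivity)
      exact_mod_cast this
  · rintro ⟨c, hc, hfin⟩
    refine ENNReal.mul_lt_top (ENNReal.pow_lt_top (ENNReal.natCast_lt_top _)) ?_
    refine lt_of_le_of_lt (ENNReal.tsum_le_tsum fun j => ?_) (lt_top_iff_ne_top.2 hfin)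
    refine mul_le_mul_left ?_ _
    refine iSup₂_le fun m n => ?_
    rw [slant]
    split_ifs with h
    · rw [ofReal_norm, ← (slantIndex_sub_eq_iff α m n j).1 h]
      exact hc m n
    · simp

/-- The index `n` and the slant `i = ⌊α⁻¹ n⌋ - m` of a transposed matrix determine the slant
`⌊α m⌋ - n` up to a box of fixed size around `-⌊α i⌋`. -/
theorem exists_transposed_slant {α : ℝ} (hα : α ≠ 0) :
    ∃ R : ℕ, ∀ m n : Fin d → ℤ,
      slantIndex α m - n + slantIndex α (slantIndex α⁻¹ n - m) ∈
        Finset.Icc (fun _ : Fin d => -(R : ℤ)) (fun _ => (R : ℤ)) := by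
  obtain ⟨R, hR⟩ := exists_nat_gt (|α| + 2)
  refine ⟨R, fun m n => ?_⟩
  have key : ∀ k, |⌊α * (m k : ℝ)⌋ - n k + ⌊α * ((⌊α⁻¹ * (n k : ℝ)⌋ - m k : ℤ) : ℝ)⌋| ≤ (R : ℤ) := by
    intro k
    set f := α * (m k : ℝ) with hf
    set g := α⁻¹ * (n k : ℝ) with hg
    set h := α * ((⌊g⌋ - m k : ℤ) : ℝ) with hh
    have hng : (n k : ℝ) = α * g := by rw [hg]; field_simp
    have e : f - n k + h = -(α * Int.fract g) := by
      rw [hng, hh, hf, Int.fract]; push_cast; ring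
    have b : |α * Int.fract g| ≤ |α| := by
      rw [abs_mul, abs_of_nonneg (Int.fract_nonneg g)]
      exact mul_le_of_le_one_right (abs_nonneg _) (Int.fract_lt_one g).le
    have b' := abs_le.1 b
    have h1 := Int.floor_le f
    have h2 := Int.lt_floor_add_one f
    have h3 := Int.floor_le h
    have h4 := Int.lt_floor_add_one h
    have : |((⌊f⌋ - n k + ⌊h⌋ : ℤ) : ℝ)| ≤ R := by
      rw [abs_le]; push_cast; constructor <;> linarith
    exact_mod_cast this
  rw [Finset.mem_Icc]
  exact ⟨fun k => (abs_le.1 (key k)).1, fun k => (abs_le.1 (key k)).2⟩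

theorem exists_one_add_norm_le_slantIndex {α : ℝ} (hα : α ≠ 0) (b : Fin d → ℤ) :
    ∃ L : ℝ, 0 ≤ L ∧ ∀ i : Fin d → ℤ, 1 + ‖i‖ ≤ L * (1 + ‖b - slantIndex α i‖) := by
  have hα' : 0 < |α| := abs_pos.2 hα
  refine ⟨1 + |α|⁻¹ * (1 + ‖b‖), by positivity, fun i => ?_⟩
  have h1 : |α| * ‖i‖ ≤ 1 + ‖slantIndex α i‖ := by
    rw [← Real.norm_eq_abs, mul_comm, ← le_div_iff₀ (by simpa using hα)]
    refine (pi_norm_le_iff_of_nonneg (by positivity)).2 fun k => ?_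
    rw [le_div_iff₀ (by simpa using hα)]
    have h2 : ‖slantIndex α i k‖ ≤ ‖slantIndex α i‖ := norm_le_pi_norm _ k
    rw [Int.norm_eq_abs] at h2 ⊢
    rw [Real.norm_eq_abs, mul_comm, ← abs_mul]
    simp only [slantIndex] at h2
    have h3 : |Int.fract (α * (i k : ℝ))| ≤ 1 := by
      rw [abs_of_nonneg (Int.fract_nonneg _)]
      exact (Int.fract_lt_one _).le
    have h4 := abs_add_le (Int.fract (α * (i k : ℝ))) (⌊α * (i k : ℝ)⌋ : ℝ)
    rw [Int.fract_add_floor] at h4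
    linarith
  have h2 : ‖slantIndex α i‖ ≤ ‖b‖ + ‖b - slantIndex α i‖ := by
    simpa using norm_sub_le b (b - slantIndex α i)
  have h3 : ‖i‖ ≤ |α|⁻¹ * (1 + ‖b‖ + ‖b - slantIndex α i‖) := by
    rw [inv_mul_eq_div, le_div_iff₀ hα']
    linarith
  have h4 := norm_nonneg (b - slantIndex α i)
  have h5 := norm_nonneg b
  have h6 : 0 ≤ |α|⁻¹ * (‖b‖ * ‖b - slantIndex α i‖) := by positivity
  nlinarith

/-- Transposition exchanges `α`-slants and `α⁻¹`-slants: a matrix whose entry at `(n, m)` is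
bounded by a weighted summable function of `⌊α m⌋ - n` has summable `α⁻¹`-slants. -/
theorem summableSlants_inv_of_transposed {α : ℝ} (hα : α ≠ 0) {s : ℝ} (hs : 0 ≤ s)
    {a : OpMatrix d X Y} {c : (Fin d → ℤ) → ℝ≥0∞} (hc : ∑' j, c j * weight s j ≠ ∞)
    (ha : ∀ n m, ‖a n m‖ₑ ≤ c (slantIndex α m - n)) :
    SummableSlants α⁻¹ (polyWeight d s) a := by
  rw [summableSlants_iff (inv_ne_zero hα)]
  obtain ⟨R, hR⟩ := exists_transposed_slant (d := d) hα
  obtain ⟨K, hK⟩ := exists_fiberBound_slantIndex (d := d) hα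
  set B := Finset.Icc (fun _ : Fin d => -(R : ℤ)) (fun _ => (R : ℤ))
  refine ⟨fun i => ∑ b ∈ B, c (b - slantIndex α i), fun n m => (ha n m).trans ?_, ?_⟩
  · have := Finset.single_le_sum (f := fun b => c (b - slantIndex α (slantIndex α⁻¹ n - m)))
      (fun _ _ => zero_le) (hR m n)
    simpa using this
  · simp_rw [Finset.sum_mul]
    rw [Summable.tsum_finsetSum fun _ _ => ENNReal.summable]
    refine (ENNReal.sum_lt_top.2 fun b _ => ?_).ne
    obtain ⟨L, hL0, hL⟩ := exists_one_add_norm_le_slantIndex hα b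
    have hfib : FiberBound (fun i => b - slantIndex (d := d) α i) K :=
      hK.comp_injective (g := fun j => b - j) sub_right_injective
    calc ∑' i, c (b - slantIndex α i) * weight s i
        ≤ ∑' i, ENNReal.ofReal L ^ s *
            (c (b - slantIndex α i) * weight s (b - slantIndex α i)) := by
          refine ENNReal.tsum_le_tsum fun i => ?_
          calc _ ≤ c (b - slantIndex α i) *
                (ENNReal.ofReal L ^ s * weight s (b - slantIndex α i)) := by
                gcongr
                exact exists_weight_le hs hL hL0 i
            _ = _ := by ring
      _ ≤ ENNReal.ofReal L ^ s * (K * ∑' j, c j * weight s j) := by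
          rw [ENNReal.tsum_mul_left]
          gcongr
          exact hfib.tsum_comp_le fun j => c j * weight s j
      _ < ∞ := ENNReal.mul_lt_top (ENNReal.rpow_lt_top_of_nonneg hs ENNReal.ofReal_ne_top)
          (ENNReal.mul_lt_top (ENNReal.natCast_lt_top K) (lt_top_iff_ne_top.2 hc))

end Envelope

/-! ### Operators on `ℓ^q` given by matrices -/

section Operators

variable {d : ℕ} {X Y Z : Type*} [NormedAddCommGroup X] [NormedSpace ℂ X]
  [NormedAddCommGroup Y] [NormedSpace ℂ Y] [NormedAddCommGroup Z] [NormedSpace ℂ Z]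

theorem ne_zero_of_fact {q : ℝ≥0∞} [hq : Fact (1 ≤ q)] : q ≠ 0 :=
  (zero_lt_one.trans_le hq.out).ne'

/-- A sequence dominated by a reindexing with bounded fibres of an `ℓ^q` sequence is in `ℓ^q`. -/
theorem FiberBound.memℓp {d : ℕ} {X Y : Type*} [NormedAddCommGroup X] [NormedAddCommGroup Y]
    {q : ℝ≥0∞} [hq : Fact (1 ≤ q)] {ψ : (Fin d → ℤ) → Fin d → ℤ} {K : ℕ}
    (hψ : FiberBound ψ K) (hK : 1 ≤ K) {C : ℝ} (hC : 0 ≤ C) 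
    (z : lp (fun _ : Fin d → ℤ => X) q) {f : (Fin d → ℤ) → Y} (hf : ∀ m, ‖f m‖ ≤ C * ‖(z : (Fin d → ℤ) → X) (ψ m)‖) :
    ∃ h : Memℓp f q, ‖(⟨f, h⟩ : lp (fun _ : Fin d → ℤ => Y) q)‖ ≤ C * K * ‖z‖ := by
  classical
  have hK' : (1 : ℝ) ≤ K := by exact_mod_cast hK
  rcases eq_or_ne q ∞ with rfl | hq'
  · have hb : ∀ m, ‖f m‖ ≤ C * K * ‖z‖ := fun m => by
      calc ‖f m‖ ≤ C * ‖(z : (Fin d → ℤ) → X) (ψ m)‖ := hf m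
        _ ≤ C * ‖z‖ := by gcongr; exact lp.norm_apply_le_norm ENNReal.top_ne_zero z _
        _ ≤ C * K * ‖z‖ := by gcongr; exact le_mul_of_one_le_right hC hK'
    exact ⟨memℓp_infty ⟨_, by rintro _ ⟨m, rfl⟩; exact hb m⟩,
      lp.norm_le_of_forall_le (by positivity) hb⟩
  · have hq1 : 1 ≤ q.toReal := by
      simpa using ENNReal.toReal_mono hq' hq.out
    have hq0 : 0 < q.toReal := by linarith
    have hsum : ∀ F : Finset (Fin d → ℤ), ∑ m ∈ F, ‖f m‖ ^ q.toReal ≤ (C * K * ‖z‖) ^ q.toReal := by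
      intro F
      calc ∑ m ∈ F, ‖f m‖ ^ q.toReal
          ≤ ∑ m ∈ F, C ^ q.toReal * ‖(z : (Fin d → ℤ) → X) (ψ m)‖ ^ q.toReal := by
            refine Finset.sum_le_sum fun m _ => ?_
            rw [← Real.mul_rpow hC (norm_nonneg _)]
            gcongr
            exact hf m
        _ ≤ C ^ q.toReal * (K * ∑ n ∈ F.image ψ, ‖(z : (Fin d → ℤ) → X) n‖ ^ q.toReal) := by
            rw [← Finset.mul_sum]
            gcongr
            exact hψ.sum_comp_le (f := fun n => ‖(z : (Fin d → ℤ) → X) n‖ ^ q.toReal)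
              (fun n => by positivity) F
        _ ≤ C ^ q.toReal * ((K : ℝ) ^ q.toReal * ‖z‖ ^ q.toReal) := by
            gcongr
            · exact Real.self_le_rpow_of_one_le hK' hq1
            · exact lp.sum_rpow_le_norm_rpow hq0 z _
        _ = (C * K * ‖z‖) ^ q.toReal := by
            rw [Real.mul_rpow (by positivity) (norm_nonneg _), Real.mul_rpow hC (by positivity),
              mul_assoc]
    exact ⟨memℓp_gen' hsum, lp.norm_le_of_forall_sum_le hq0 (by positivity) hsum⟩

/-- The operator with one slant: `x ↦ (b m (x (ψ m)))_m`. -/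
theorem exists_weighted_composition (q : ℝ≥0∞) [Fact (1 ≤ q)] {ψ : (Fin d → ℤ) → Fin d → ℤ}
    {K : ℕ} (hψ : FiberBound ψ K) (hK : 1 ≤ K) {C : ℝ} (hC : 0 ≤ C)
    {b : (Fin d → ℤ) → X →L[ℂ] Y} (hb : ∀ m, ‖b m‖ ≤ C) :
    ∃ T : Seq d X q →L[ℂ] Seq d Y q, ‖T‖ ≤ C * K ∧
      ∀ x m, (T x : (Fin d → ℤ) → Y) m = b m ((x : (Fin d → ℤ) → X) (ψ m)) := by
  have h : ∀ x : Seq d X q, ∃ h : Memℓp (fun m => b m ((x : (Fin d → ℤ) → X) (ψ m))) q,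
      ‖(⟨_, h⟩ : Seq d Y q)‖ ≤ C * K * ‖x‖ := fun x =>
    hψ.memℓp hK hC x fun m => (b m).le_of_opNorm_le (hb m) _
  let T₀ : Seq d X q →ₗ[ℂ] Seq d Y q :=
    { toFun := fun x => ⟨_, (h x).1⟩
      map_add' := fun x y => by
        ext m
        exact map_add (b m) _ _
      map_smul' := fun c x => by
        ext m
        exact map_smul (b m) c _ }
  exact ⟨T₀.mkContinuous (C * K) fun x => (h x).2, T₀.mkContinuous_norm_le (by positivity) _,
    fun _ _ => rfl⟩

/-- A matrix with summable slants acts on every `ℓ^q`, with a bound that does not depend on `q`: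
sum the operators given by the single slants. -/
theorem exists_represents [CompleteSpace Y] (q : ℝ≥0∞) [Fact (1 ≤ q)]
    {φ : (Fin d → ℤ) → Fin d → ℤ} {K : ℕ} (hφ : FiberBound φ K) (hK : 1 ≤ K)
    {c : (Fin d → ℤ) → ℝ≥0∞} (hc : ∑' j, c j ≠ ∞) {a : OpMatrix d X Y}
    (ha : ∀ m n, ‖a m n‖ₑ ≤ c (φ m - n)) :
    ∃ T : Seq d X q →L[ℂ] Seq d Y q, Represents a T ∧ ‖T‖ ≤ (∑' j, c j).toReal * K := by
  have hcj : ∀ j, c j ≠ ∞ := ENNReal.ne_top_of_tsum_ne_top hc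
  have hcs : Summable fun j => (c j).toReal := ENNReal.summable_toReal hc
  have hb : ∀ j m, ‖a m (φ m - j)‖ ≤ (c j).toReal := fun j m => by
    rw [← toReal_enorm]
    refine ENNReal.toReal_mono (hcj j) ?_
    simpa using ha m (φ m - j)
  choose T hT hTx using fun j => exists_weighted_composition q
    (hφ.comp_injective (g := fun n => n - j) sub_left_injective) hK ENNReal.toReal_nonneg (hb j)
  have hTs : HasSum (fun j => (c j).toReal * (K : ℝ)) ((∑' j, c j).toReal * K) := by
    rw [ENNReal.tsum_toReal_eq hcj]
    exact hcs.hasSum.mul_right _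
  have hsum : Summable T := Summable.of_norm_bounded hTs.summable hT
  refine ⟨∑' j, T j, fun x m => ?_, tsum_of_norm_bounded hTs hT⟩
  have h1 := (hsum.hasSum.mapL (ContinuousLinearMap.apply ℂ (Seq d Y q) x)).mapL
    (lp.evalCLM ℂ (fun _ : Fin d → ℤ => Y) q m)
  have h2 := (Equiv.subLeft (φ m)).hasSum_iff.2 h1
  convert h2 using 2 with n
  · change _ = (T (φ m - n) x : (Fin d → ℤ) → Y) m
    rw [hTx, sub_sub_cancel]
  · rfl

theorem Represents.unique {q : ℝ≥0∞} [Fact (1 ≤ q)] {a : OpMatrix d X Y}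
    {T U : Seq d X q →L[ℂ] Seq d Y q} (hT : Represents a T) (hU : Represents a U) : T = U := by
  ext x m
  exact (hT x m).unique (hU x m)

/-- The entry of a represented matrix, read off from the operator. -/
theorem Represents.apply_single {q : ℝ≥0∞} [Fact (1 ≤ q)] {a : OpMatrix d X Y}
    {T : Seq d X q →L[ℂ] Seq d Y q} (hT : Represents a T) (m n : Fin d → ℤ) (x : X) :
    (T (lp.single q n x) : (Fin d → ℤ) → Y) m = a m n x := by
  refine (hT (lp.single q n x) m).unique ?_
  convert hasSum_single n fun k hk => ?_
  · simp
  · rw [lp.single_apply_ne _ _ _ hk, map_zero]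

theorem Represents.matrix_unique {q : ℝ≥0∞} [Fact (1 ≤ q)] {a b : OpMatrix d X Y}
    {T : Seq d X q →L[ℂ] Seq d Y q} (ha : Represents a T) (hb : Represents b T) : a = b := by
  funext m n
  ext x
  rw [← ha.apply_single, hb.apply_single]

/-- The identity matrix. -/
def oneMatrix (d : ℕ) (X : Type*) [NormedAddCommGroup X] [NormedSpace ℂ X] : OpMatrix d X X :=
  fun m n => if n = m then ContinuousLinearMap.id ℂ X else 0

theorem represents_one (q : ℝ≥0∞) [Fact (1 ≤ q)] :
    Represents (oneMatrix d X) (ContinuousLinearMap.id ℂ (Seq d X q)) := by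
  intro x m
  convert hasSum_single m fun k hk => ?_
  · simp [oneMatrix]
  · simp [oneMatrix, hk]

/-- The matrix product; it is meant for matrices whose rows are uniformly summable. -/
def mulMatrix (a : OpMatrix d Y Z) (b : OpMatrix d X Y) : OpMatrix d X Z :=
  fun m n => ∑' k, (a m k) ∘L (b k n)

/-- The rows of `a` are absolutely summable, uniformly. -/
def RowBounded (a : OpMatrix d X Y) : Prop :=
  ∃ C : ℝ≥0∞, C ≠ ∞ ∧ ∀ m, ∑' n, ‖a m n‖ₑ ≤ C

theorem rowBounded_of_envelope {φ : (Fin d → ℤ) → Fin d → ℤ} {c : (Fin d → ℤ) → ℝ≥0∞}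
    (hc : ∑' j, c j ≠ ∞) {a : OpMatrix d X Y} (ha : ∀ m n, ‖a m n‖ₑ ≤ c (φ m - n)) :
    RowBounded a := by
  refine ⟨_, hc, fun m => (ENNReal.tsum_le_tsum (ha m)).trans ?_⟩
  exact ((Equiv.subLeft (φ m)).tsum_eq c).le

theorem summable_of_tsum_enorm_ne_top {ι E : Type*} [NormedAddCommGroup E] [CompleteSpace E]
    {f : ι → E} (h : ∑' i, ‖f i‖ₑ ≠ ∞) : Summable f := by
  refine Summable.of_norm ?_
  simpa using ENNReal.summable_toReal h

theorem tsum_enorm_comp_le {a : OpMatrix d Y Z} {b : OpMatrix d X Y} {Ca Cb : ℝ≥0∞}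
    (ha : ∀ m, ∑' n, ‖a m n‖ₑ ≤ Ca) (hb : ∀ m, ∑' n, ‖b m n‖ₑ ≤ Cb) (m : Fin d → ℤ) :
    ∑' (k) (n), ‖a m k‖ₑ * ‖b k n‖ₑ ≤ Ca * Cb := by
  simp_rw [ENNReal.tsum_mul_left]
  calc ∑' k, ‖a m k‖ₑ * ∑' n, ‖b k n‖ₑ ≤ ∑' k, ‖a m k‖ₑ * Cb := by
        gcongr with k
        exact hb k
    _ ≤ Ca * Cb := by
        rw [ENNReal.tsum_mul_right]
        gcongr
        exact ha m

theorem enorm_mulMatrix_le (a : OpMatrix d Y Z) (b : OpMatrix d X Y)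
    (m n : Fin d → ℤ) : ‖mulMatrix a b m n‖ₑ ≤ ∑' k, ‖a m k‖ₑ * ‖b k n‖ₑ := by
  unfold mulMatrix
  refine (enorm_tsum_le_tsum_enorm (f := fun k => (a m k) ∘L (b k n))).trans
    (ENNReal.tsum_le_tsum fun k => ?_)
  exact ContinuousLinearMap.opENorm_comp_le (a m k) (b k n)

/-- The product matrix represents the composition. -/
theorem Represents.mul [CompleteSpace Z] {q : ℝ≥0∞} [Fact (1 ≤ q)] {a : OpMatrix d Y Z}
    {b : OpMatrix d X Y} (har : RowBounded a) (hbr : RowBounded b)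
    {T : Seq d Y q →L[ℂ] Seq d Z q} {U : Seq d X q →L[ℂ] Seq d Y q}
    (hT : Represents a T) (hU : Represents b U) : Represents (mulMatrix a b) (T ∘L U) := by
  obtain ⟨Ca, hCa, ha⟩ := har
  obtain ⟨Cb, hCb, hb⟩ := hbr
  intro x m
  have hx : ∀ n, ‖(x : (Fin d → ℤ) → X) n‖ₑ ≤ ‖x‖ₑ := fun n => by
    rw [← ofReal_norm, ← ofReal_norm]
    exact ENNReal.ofReal_le_ofReal (lp.norm_apply_le_norm ne_zero_of_fact x n)
  have hfin : ∑' (k) (n), ‖a m k‖ₑ * ‖b k n‖ₑ ≠ ∞ :=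
    ne_top_of_le_ne_top (ENNReal.mul_ne_top hCa hCb) (tsum_enorm_comp_le ha hb m)
  have hs : Summable fun z : (Fin d → ℤ) × (Fin d → ℤ) =>
      a m z.1 (b z.1 z.2 ((x : (Fin d → ℤ) → X) z.2)) := by
    refine summable_of_tsum_enorm_ne_top (ne_top_of_le_ne_top
      (ENNReal.mul_ne_top hfin (enorm_ne_top (x := x))) ?_)
    rw [ENNReal.tsum_prod', ← ENNReal.tsum_mul_right]
    refine ENNReal.tsum_le_tsum fun k => ?_
    rw [← ENNReal.tsum_mul_right]
    refine ENNReal.tsum_le_tsum fun n => ?_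
    calc _ ≤ ‖a m k‖ₑ * (‖b k n‖ₑ * ‖(x : (Fin d → ℤ) → X) n‖ₑ) := by
          refine ((a m k).le_opENorm _).trans ?_
          gcongr
          exact (b k n).le_opENorm _
      _ ≤ _ := by
          rw [mul_assoc]
          gcongr
          exact hx n
  -- the double series, summed first over `n` and then over `k`, and in the other order
  have h1 := hs.hasSum.prod_fiberwise fun k => (hU x k).mapL (a m k)
  have h2 := h1.unique (hT (U x) m)
  have h3 := ((Equiv.prodComm _ _).hasSum_iff.2 hs.hasSum).prod_fiberwise (g := fun n =>
    mulMatrix a b m n ((x : (Fin d → ℤ) → X) n)) fun n => ?_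
  · rw [h2] at h3
    exact h3
  · have h4 : Summable fun k => (a m k) ∘L (b k n) := by
      refine summable_of_tsum_enorm_ne_top (ne_top_of_le_ne_top hfin ?_)
      refine ENNReal.tsum_le_tsum fun k => (ContinuousLinearMap.opENorm_comp_le _ _).trans ?_
      exact ENNReal.le_tsum (f := fun n => ‖a m k‖ₑ * ‖b k n‖ₑ) n
    exact h4.hasSum.mapL (ContinuousLinearMap.apply ℂ Z ((x : (Fin d → ℤ) → X) n))

end Operators

/-! ### Off-diagonal decay of operators on `ℓ²` -/

section Hilbert

variable {d : ℕ} {X Y : Type*} [NormedAddCommGroup X] [InnerProductSpace ℂ X]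
  [NormedAddCommGroup Y] [InnerProductSpace ℂ Y]

/-- The matrix of a bounded operator on `ℓ²`. -/
def entry (T : Seq d X 2 →L[ℂ] Seq d Y 2) : OpMatrix d X Y := fun m n =>
  (lp.evalCLM ℂ (fun _ : Fin d → ℤ => Y) 2 m) ∘L T ∘L
    (lp.singleContinuousLinearMap ℂ (fun _ : Fin d → ℤ => X) 2 n)

theorem entry_apply (T : Seq d X 2 →L[ℂ] Seq d Y 2) (m n : Fin d → ℤ) (x : X) :
    entry T m n x = (T (lp.single 2 n x) : (Fin d → ℤ) → Y) m := rfl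

theorem represents_entry (T : Seq d X 2 →L[ℂ] Seq d Y 2) : Represents (entry T) T := by
  intro x m
  exact ((lp.hasSum_single ENNReal.ofNat_ne_top x).mapL T).mapL
    (lp.evalCLM ℂ (fun _ : Fin d → ℤ => Y) 2 m)

theorem enorm_entry_le (T : Seq d X 2 →L[ℂ] Seq d Y 2) (m n : Fin d → ℤ) :
    ‖entry T m n‖ₑ ≤ ‖T‖ₑ := by
  rw [← ofReal_norm, ← ofReal_norm]
  refine ENNReal.ofReal_le_ofReal (ContinuousLinearMap.opNorm_le_bound _ (norm_nonneg _) fun x => ?_)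
  rw [entry_apply]
  refine (lp.norm_apply_le_norm two_ne_zero _ m).trans ((T.le_opNorm _).trans_eq ?_)
  rw [lp.norm_single two_pos]

theorem enorm_entry_mul_le (S T : Seq d X 2 →L[ℂ] Seq d X 2) (m n : Fin d → ℤ) :
    ‖entry (S * T) m n‖ₑ ≤ ∑' k, ‖entry S m k‖ₑ * ‖entry T k n‖ₑ := by
  refine ContinuousLinearMap.opENorm_le_bound _ fun x => ?_
  have h := represents_entry S (T (lp.single 2 n x)) m
  change ‖(S (T (lp.single 2 n x)) : (Fin d → ℤ) → X) m‖ₑ ≤ _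
  rw [← h.tsum_eq, ← ENNReal.tsum_mul_right]
  refine enorm_tsum_le_tsum_enorm.trans (ENNReal.tsum_le_tsum fun k => ?_)
  rw [mul_assoc]
  refine ((entry S m k).le_opENorm _).trans ?_
  gcongr
  exact (entry T k n).le_opENorm x

/-- The largest norm of an entry on the `j`-th side diagonal. -/
def offDiag (T : Seq d X 2 →L[ℂ] Seq d X 2) (j : Fin d → ℤ) : ℝ≥0∞ :=
  ⨆ m, ‖entry T m (m - j)‖ₑ

/-- The weighted sum of the norms of the side diagonals of an operator on `ℓ²`. -/
def decayNorm (s : ℝ) (T : Seq d X 2 →L[ℂ] Seq d X 2) : ℝ≥0∞ :=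
  ∑' j, offDiag T j * weight s j

theorem enorm_entry_le_offDiag (T : Seq d X 2 →L[ℂ] Seq d X 2) (m n : Fin d → ℤ) :
    ‖entry T m n‖ₑ ≤ offDiag T (m - n) := by
  refine le_trans (le_of_eq ?_) (le_iSup (fun m' => ‖entry T m' (m' - (m - n))‖ₑ) m)
  rw [sub_sub_cancel]

theorem offDiag_le {T : Seq d X 2 →L[ℂ] Seq d X 2} {e : (Fin d → ℤ) → ℝ≥0∞}
    (h : ∀ m n, ‖entry T m n‖ₑ ≤ e (m - n)) (j : Fin d → ℤ) : offDiag T j ≤ e j :=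
  iSup_le fun m => by simpa using h m (m - j)

theorem offDiag_le_enorm (T : Seq d X 2 →L[ℂ] Seq d X 2) (j : Fin d → ℤ) :
    offDiag T j ≤ ‖T‖ₑ :=
  offDiag_le (e := fun _ => ‖T‖ₑ) (enorm_entry_le T) j

theorem decayNorm_le {s : ℝ} {T : Seq d X 2 →L[ℂ] Seq d X 2} {e : (Fin d → ℤ) → ℝ≥0∞}
    (h : ∀ m n, ‖entry T m n‖ₑ ≤ e (m - n)) : decayNorm s T ≤ ∑' j, e j * weight s j :=
  ENNReal.tsum_le_tsum fun j => mul_le_mul_left (offDiag_le h j) _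

theorem offDiag_mul_le (S T : Seq d X 2 →L[ℂ] Seq d X 2) (j : Fin d → ℤ) :
    offDiag (S * T) j ≤ ∑' i, offDiag S i * offDiag T (j - i) := by
  refine offDiag_le (e := fun j => ∑' i, offDiag S i * offDiag T (j - i)) (fun m n => ?_) j
  rw [← (Equiv.subLeft m).tsum_eq]
  refine (enorm_entry_mul_le S T m n).trans (ENNReal.tsum_le_tsum fun k => ?_)
  refine mul_le_mul' (enorm_entry_le_offDiag S m k) ?_
  have := enorm_entry_le_offDiag T k n
  simpa using this

theorem decayNorm_mul_le {s : ℝ} (hs : 0 ≤ s) (S T : Seq d X 2 →L[ℂ] Seq d X 2) :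
    decayNorm s (S * T) ≤ decayNorm s S * decayNorm s T :=
  (ENNReal.tsum_le_tsum fun j => mul_le_mul_left (offDiag_mul_le S T j) _).trans
    (tsum_conv_mul_weight_le hs _ _)

/-- In a square, the weight falls on one factor only, up to the constant `2 ^ s`. -/
theorem decayNorm_mul_self_le {s : ℝ} (hs : 0 ≤ s) (T : Seq d X 2 →L[ℂ] Seq d X 2) :
    decayNorm s (T * T) ≤ 2 ^ s * 2 * decayNorm s T * decayNorm 0 T := by
  refine (ENNReal.tsum_le_tsum fun j => mul_le_mul_left (offDiag_mul_le T T j) _).trans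
    ((tsum_conv_mul_weight_le_add hs _ _).trans_eq ?_)
  simp only [decayNorm, weight_exponent_zero, mul_one]
  ring

theorem decayNorm_one_le (s : ℝ) : decayNorm s (1 : Seq d X 2 →L[ℂ] Seq d X 2) ≤ 1 := by
  refine (decayNorm_le (e := fun j => if j = 0 then 1 else 0) fun m n => ?_).trans ?_
  · split_ifs with h
    · refine (enorm_entry_le _ m n).trans ?_
      rw [← ofReal_norm, ← ENNReal.ofReal_one]
      exact ENNReal.ofReal_le_ofReal ContinuousLinearMap.norm_id_le
    · refine ContinuousLinearMap.opENorm_le_bound _ fun x => ?_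
      have : entry (1 : Seq d X 2 →L[ℂ] Seq d X 2) m n x = 0 :=
        lp.single_apply_ne (E := fun _ : Fin d → ℤ => X) 2 n x (sub_ne_zero.1 h)
      rw [this, enorm_zero]
      exact zero_le
  · rw [tsum_eq_single 0 fun j hj => by simp [hj]]
    simp

theorem decayNorm_pow_le {s : ℝ} (hs : 0 ≤ s) (T : Seq d X 2 →L[ℂ] Seq d X 2) (k : ℕ) :
    decayNorm s (T ^ k) ≤ decayNorm s T ^ k := by
  induction k with
  | zero => simpa using decayNorm_one_le s
  | succ k ih =>
    rw [pow_succ, pow_succ]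
    exact (decayNorm_mul_le hs _ _).trans (mul_le_mul_left ih _)

theorem decayNorm_le_tsum {ι : Type*} {f : ι → Seq d X 2 →L[ℂ] Seq d X 2}
    {T : Seq d X 2 →L[ℂ] Seq d X 2} (h : HasSum f T) (s : ℝ) :
    decayNorm s T ≤ ∑' i, decayNorm s (f i) := by
  refine (decayNorm_le (e := fun j => ∑' i, offDiag (f i) j) fun m n => ?_).trans_eq ?_
  · refine ContinuousLinearMap.opENorm_le_bound _ fun x => ?_
    have h1 := (h.mapL (ContinuousLinearMap.apply ℂ (Seq d X 2) (lp.single 2 n x))).mapL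
      (lp.evalCLM ℂ (fun _ : Fin d → ℤ => X) 2 m)
    have h2 : HasSum (fun i => entry (f i) m n x) (entry T m n x) := h1
    rw [← h2.tsum_eq, ← ENNReal.tsum_mul_right]
    refine enorm_tsum_le_tsum_enorm.trans (ENNReal.tsum_le_tsum fun i => ?_)
    refine ((entry (f i) m n).le_opENorm x).trans ?_
    gcongr
    exact enorm_entry_le_offDiag _ m n
  · simp_rw [decayNorm, ← ENNReal.tsum_mul_right]
    exact ENNReal.tsum_comm

theorem decayNorm_finsetSum_ne_top {ι : Type*} {f : ι → Seq d X 2 →L[ℂ] Seq d X 2} {s : ℝ}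
    (F : Finset ι) (h : ∀ i, decayNorm s (f i) ≠ ∞) : decayNorm s (∑ i ∈ F, f i) ≠ ∞ := by
  refine ne_top_of_le_ne_top ?_ (decayNorm_le_tsum (F.hasSum f) s)
  rw [tsum_fintype]
  exact (ENNReal.sum_lt_top.2 fun i _ => (h _).lt_top).ne

theorem decayNorm_sub_le (s : ℝ) (S T : Seq d X 2 →L[ℂ] Seq d X 2) :
    decayNorm s (S - T) ≤ decayNorm s S + decayNorm s T := by
  refine (decayNorm_le (e := fun j => offDiag S j + offDiag T j) fun m n => ?_).trans_eq ?_
  · have : entry (S - T) m n = entry S m n - entry T m n := by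
      ext x
      rfl
    rw [this]
    exact enorm_sub_le.trans (add_le_add (enorm_entry_le_offDiag S m n)
      (enorm_entry_le_offDiag T m n))
  · simp_rw [add_mul]
    exact ENNReal.tsum_add

theorem decayNorm_smul_le (s : ℝ) (t : ℂ) (T : Seq d X 2 →L[ℂ] Seq d X 2) :
    decayNorm s (t • T) ≤ ‖t‖ₑ * decayNorm s T := by
  refine (decayNorm_le (e := fun j => ‖t‖ₑ * offDiag T j) fun m n => ?_).trans_eq ?_
  · have : entry (t • T) m n = t • entry T m n := by
      ext x
      rfl
    rw [this, enorm_smul]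
    gcongr
    exact enorm_entry_le_offDiag T m n
  · simp_rw [mul_assoc, ENNReal.tsum_mul_left]
    rfl

/-- Interpolation: near the diagonal the entries are bounded by the operator norm, far from it
by the weighted norm. -/
theorem decayNorm_zero_le {s : ℝ} (hs : 1 ≤ s) (T : Seq d X 2 →L[ℂ] Seq d X 2) (R : ℕ) :
    decayNorm 0 T ≤ (2 * R + 1) ^ d * ‖T‖ₑ + (1 + (R : ℝ≥0∞))⁻¹ * decayNorm s T := by
  set B := Finset.Icc (fun _ : Fin d => -(R : ℤ)) (fun _ => (R : ℤ)) with hB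
  have hcard : (B.card : ℝ≥0∞) = (2 * R + 1) ^ d := by
    rw [hB, Pi.card_Icc]
    simp only [Int.card_Icc, Finset.prod_const, Finset.card_univ, Fintype.card_fin]
    have : ((R : ℤ) + 1 - -(R : ℤ)).toNat = 2 * R + 1 := by omega
    rw [this]
    push_cast
    rfl
  have hpt : ∀ j, offDiag T j ≤
      (if j ∈ B then ‖T‖ₑ else 0) + (1 + (R : ℝ≥0∞))⁻¹ * (offDiag T j * weight s j) := by
    intro j
    split_ifs with hj
    · exact (offDiag_le_enorm T j).trans le_self_add
    · have hR : (R : ℝ) ≤ ‖j‖ := by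
        by_contra! hlt
        refine hj (Finset.mem_Icc.2 ⟨fun k => ?_, fun k => ?_⟩) <;>
        · have h1 := (norm_le_pi_norm j k).trans hlt.le
          rw [Int.norm_eq_abs] at h1
          have h2 : |j k| ≤ (R : ℤ) := by exact_mod_cast h1
          have h3 := abs_le.1 h2
          first | exact h3.1 | exact h3.2
      have hw : (1 + (R : ℝ≥0∞)) ≤ weight s j := by
        refine le_trans ?_ (weight_mono_exponent hs j)
        rw [weight_eq_rpow, ENNReal.rpow_one, ENNReal.ofReal_add zero_le_one (norm_nonneg _),
          ENNReal.ofReal_one, ← ENNReal.ofReal_natCast]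
        gcongr
      have h1 : 1 ≤ (1 + (R : ℝ≥0∞))⁻¹ * weight s j := by
        calc (1 : ℝ≥0∞) = (1 + (R : ℝ≥0∞))⁻¹ * (1 + (R : ℝ≥0∞)) :=
              (ENNReal.inv_mul_cancel (by simp) (by finiteness)).symm
          _ ≤ _ := by gcongr
      rw [zero_add]
      calc offDiag T j ≤ offDiag T j * ((1 + (R : ℝ≥0∞))⁻¹ * weight s j) :=
            le_mul_of_one_le_right' h1
        _ = _ := by ring
  calc decayNorm 0 T = ∑' j, offDiag T j := by simp [decayNorm]
    _ ≤ ∑' j, ((if j ∈ B then ‖T‖ₑ else 0) +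
          (1 + (R : ℝ≥0∞))⁻¹ * (offDiag T j * weight s j)) := ENNReal.tsum_le_tsum hpt
    _ = _ := by
      rw [ENNReal.tsum_add, ENNReal.tsum_mul_left, ← hcard,
        tsum_eq_sum (s := B) fun j hj => by simp [hj]]
      congr 1
      rw [Finset.sum_ite_mem, Finset.inter_self, Finset.sum_const, nsmul_eq_mul]

/-- If `1 ≤ a n` for all `n`, then the recursive bound gives `K a n ≤ (K a 0 ν ^ n) ^ (2 ^ n)`,
which tends to `0`. -/
theorem exists_lt_one_of_le_sq {a : ℕ → ℝ≥0∞} {K ν : ℝ≥0∞} (hK : 1 ≤ K) (hK' : K ≠ ∞)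
    (ha : a 0 ≠ ∞) (hν : ν < 1)
    (h : ∀ n, 1 ≤ a n → a (n + 1) ≤ K * (ν ^ 2) ^ 2 ^ n * a n ^ 2) : ∃ n, a n < 1 := by
  by_contra! hcon
  have key : ∀ n, K * a n ≤ (K * a 0 * ν ^ n) ^ 2 ^ n := by
    intro n
    induction n with
    | zero => simp
    | succ n ih =>
      calc K * a (n + 1) ≤ K * (K * (ν ^ 2) ^ 2 ^ n * a n ^ 2) := by
            gcongr
            exact h n (hcon n)
        _ = (K * a n) ^ 2 * (ν ^ 2) ^ 2 ^ n := by ring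
        _ ≤ ((K * a 0 * ν ^ n) ^ 2 ^ n) ^ 2 * (ν ^ 2) ^ 2 ^ n := by gcongr
        _ = (K * a 0 * ν ^ (n + 1)) ^ 2 ^ (n + 1) := by
            ring
  have ht := ENNReal.Tendsto.const_mul (a := K * a 0)
    (ENNReal.tendsto_pow_atTop_nhds_zero_of_lt_one hν) (Or.inr (ENNReal.mul_ne_top hK' ha))
  rw [mul_zero] at ht
  obtain ⟨n, hn⟩ := (ht.eventually_lt_const one_pos).exists
  have h1 := (key n).trans_lt (pow_lt_one₀ zero_le hn (by positivity))
  exact absurd (hcon n) (not_le.2 ((le_mul_of_one_le_left' hK).trans_lt h1))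

/-- A radius that balances the two terms of the interpolation inequality. -/
theorem exists_radius {μ : ℝ} (h0 : 0 < μ) (h1 : μ ≤ 1) (d k : ℕ) :
    ∃ R : ℕ, (2 * (R : ℝ) + 1) ^ d * (μ ^ (d + 1)) ^ k ≤ 3 ^ d * μ ^ k ∧
      (1 + (R : ℝ))⁻¹ ≤ μ ^ k := by
  have hk : 0 < μ ^ k := pow_pos h0 k
  have hinv : 1 ≤ (μ ^ k)⁻¹ := (one_le_inv₀ hk).2 (pow_le_one₀ h0.le h1)
  refine ⟨⌊(μ ^ k)⁻¹⌋₊, ?_, ?_⟩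
  · have h2 : 2 * (⌊(μ ^ k)⁻¹⌋₊ : ℝ) + 1 ≤ 3 * (μ ^ k)⁻¹ := by
      have := Nat.floor_le (zero_le_one.trans hinv)
      linarith
    calc _ ≤ (3 * (μ ^ k)⁻¹) ^ d * (μ ^ (d + 1)) ^ k := by gcongr
      _ = 3 ^ d * (((μ ^ k)⁻¹ * μ ^ k) ^ d * μ ^ k) := by ring
      _ = 3 ^ d * μ ^ k := by rw [inv_mul_cancel₀ hk.ne', one_pow, one_mul]
  · rw [inv_le_comm₀ (by positivity) hk]
    linarith [Nat.lt_floor_add_one (μ ^ k)⁻¹]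

/-- For a strict contraction on `ℓ²` with finite weighted norm, some power has weighted norm
less than `1`. -/
theorem exists_decayNorm_pow_lt_one {s : ℝ} (hs : 1 ≤ s) {C : Seq d X 2 →L[ℂ] Seq d X 2}
    (hC : ‖C‖ < 1) (hfin : decayNorm s C ≠ ∞) : ∃ k, k ≠ 0 ∧ decayNorm s (C ^ k) < 1 := by
  have hs0 : 0 ≤ s := zero_le_one.trans hs
  -- the exponent `2 (d + 1)` leaves room for the number of entries near the diagonal
  obtain ⟨ν, hν0, hν1, hν⟩ : ∃ ν : ℝ, 0 < ν ∧ ν < 1 ∧ ‖C‖ ≤ (ν ^ 2) ^ (d + 1) := by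
    have hcont : Filter.Tendsto (fun x : ℝ => (x ^ 2) ^ (d + 1)) (nhdsWithin 1 (Set.Iio 1))
        (nhds 1) := by
      have : Continuous fun x : ℝ => (x ^ 2) ^ (d + 1) := by fun_prop
      simpa using (this.tendsto 1).mono_left nhdsWithin_le_nhds
    obtain ⟨ν, h1, h2, h3⟩ := ((hcont.eventually_const_le hC).and
      (Ioo_mem_nhdsLT (zero_lt_one (α := ℝ)))).exists
    exact ⟨ν, h2, h3, h1⟩
  set K : ℝ≥0∞ := 2 ^ s * 2 * (3 ^ d + 1) with hK
  have hν' : ENNReal.ofReal ν < 1 := by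
    rw [← ENNReal.ofReal_one]
    exact (ENNReal.ofReal_lt_ofReal_iff one_pos).2 hν1
  have h2s : (1 : ℝ≥0∞) ≤ 2 ^ s := ENNReal.one_le_rpow (by norm_num) (by linarith)
  have hK1 : 1 ≤ K := by
    rw [hK, mul_assoc]
    refine one_le_mul h2s (one_le_mul (by norm_num) le_add_self)
  have hK' : K ≠ ∞ := by
    have : (2 : ℝ≥0∞) ^ s ≠ ∞ := ENNReal.rpow_ne_top_of_nonneg hs0 (by norm_num)
    finiteness
  obtain ⟨n, hn⟩ := exists_lt_one_of_le_sq (a := fun n => decayNorm s (C ^ 2 ^ n)) hK1 hK'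
    (by simpa using hfin) hν' fun n hn => by
      set T := C ^ 2 ^ n with hT
      obtain ⟨R, hR1, hR2⟩ := exists_radius (pow_pos hν0 2) (pow_le_one₀ hν0.le hν1.le) d (2 ^ n)
      have hTn : ‖T‖ ≤ ((ν ^ 2) ^ (d + 1)) ^ 2 ^ n :=
        (norm_pow_le' C (by positivity)).trans (by gcongr)
      have e1 : (2 * (R : ℝ≥0∞) + 1) ^ d * ‖T‖ₑ ≤ 3 ^ d * (ENNReal.ofReal ν ^ 2) ^ 2 ^ n := by
        have := ENNReal.ofReal_le_ofReal
          ((mul_le_mul_of_nonneg_left hTn (by positivity)).trans hR1)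
        rw [ENNReal.ofReal_mul (by positivity), ENNReal.ofReal_mul (by positivity),
          ENNReal.ofReal_pow (by positivity), ENNReal.ofReal_pow (by positivity),
          ENNReal.ofReal_pow (by positivity), ENNReal.ofReal_pow (by positivity),
          ENNReal.ofReal_add (by positivity) (by positivity), ENNReal.ofReal_mul (by positivity),
          show ENNReal.ofReal ‖T‖ = ‖T‖ₑ from ofReal_norm T] at this
        simpa using this
      have e2 : (1 + (R : ℝ≥0∞))⁻¹ ≤ (ENNReal.ofReal ν ^ 2) ^ 2 ^ n := by
        have := ENNReal.ofReal_le_ofReal hR2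
        rw [ENNReal.ofReal_inv_of_pos (by positivity), ENNReal.ofReal_pow (by positivity),
          ENNReal.ofReal_pow (by positivity),
          ENNReal.ofReal_add (by positivity) (by positivity)] at this
        simpa using this
      have e3 : decayNorm 0 T ≤ (3 ^ d + 1) * (ENNReal.ofReal ν ^ 2) ^ 2 ^ n * decayNorm s T := by
        calc decayNorm 0 T ≤ 3 ^ d * (ENNReal.ofReal ν ^ 2) ^ 2 ^ n * 1 +
              (ENNReal.ofReal ν ^ 2) ^ 2 ^ n * decayNorm s T := by
              rw [mul_one]
              exact (decayNorm_zero_le hs T R).trans (add_le_add e1 (mul_le_mul_left e2 _))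
          _ ≤ 3 ^ d * (ENNReal.ofReal ν ^ 2) ^ 2 ^ n * decayNorm s T +
              (ENNReal.ofReal ν ^ 2) ^ 2 ^ n * decayNorm s T := by gcongr
          _ = _ := by ring
      calc decayNorm s (C ^ 2 ^ (n + 1)) = decayNorm s (T * T) := by
            rw [pow_succ, pow_mul, sq]
        _ ≤ 2 ^ s * 2 * decayNorm s T * decayNorm 0 T := decayNorm_mul_self_le hs0 T
        _ ≤ 2 ^ s * 2 * decayNorm s T *
              ((3 ^ d + 1) * (ENNReal.ofReal ν ^ 2) ^ 2 ^ n * decayNorm s T) := by gcongr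
        _ = K * (ENNReal.ofReal ν ^ 2) ^ 2 ^ n * decayNorm s T ^ 2 := by rw [hK]; ring
  exact ⟨2 ^ n, by positivity, hn⟩

/-- The Neumann series of a strict contraction with finite weighted norm has finite weighted
norm: sum it along the multiples of an exponent `k` for which the `k`-th power has weighted norm
less than `1`. -/
theorem exists_inverse_one_sub [CompleteSpace X] {s : ℝ} (hs : 1 ≤ s)
    {C : Seq d X 2 →L[ℂ] Seq d X 2} (hC : ‖C‖ < 1) (hfin : decayNorm s C ≠ ∞) :
    ∃ G : Seq d X 2 →L[ℂ] Seq d X 2, G * (1 - C) = 1 ∧ (1 - C) * G = 1 ∧ decayNorm s G ≠ ∞ := by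
  have hs0 : 0 ≤ s := zero_le_one.trans hs
  obtain ⟨k, hk0, hk⟩ := exists_decayNorm_pow_lt_one hs hC hfin
  have hD : ‖C ^ k‖ < 1 :=
    (norm_pow_le' C (Nat.pos_of_ne_zero hk0)).trans_lt (pow_lt_one₀ (norm_nonneg _) hC hk0)
  have hDs := summable_geometric_of_norm_lt_one hD
  have hright : (1 - C) * ((∑ i ∈ Finset.range k, C ^ i) * ∑' q, (C ^ k) ^ q) = 1 := by
    rw [← mul_assoc, mul_neg_geom_sum, mul_neg_geom_series _ hD]
  have hleft := geom_series_mul_neg C hC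
  refine ⟨_, ?_, hright, ne_top_of_le_ne_top (ENNReal.mul_ne_top ?_ ?_) (decayNorm_mul_le hs0 _ _)⟩
  · rw [← left_inv_eq_right_inv hleft hright]
    exact hleft
  · refine decayNorm_finsetSum_ne_top _ fun i => ?_
    exact ne_top_of_le_ne_top (ENNReal.pow_ne_top hfin) (decayNorm_pow_le hs0 C i)
  · refine ne_top_of_le_ne_top ?_ ((decayNorm_le_tsum hDs.hasSum s).trans
      (ENNReal.tsum_le_tsum fun q => decayNorm_pow_le hs0 (C ^ k) q))
    rw [ENNReal.tsum_geometric]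
    exact ENNReal.inv_ne_top.2 (tsub_pos_of_lt hk).ne'

variable [CompleteSpace X] [CompleteSpace Y]

theorem represents_adjoint {a : OpMatrix d X Y} {T : Seq d X 2 →L[ℂ] Seq d Y 2}
    (hT : Represents a T) : Represents (adjointMatrix a) (ContinuousLinearMap.adjoint T) := by
  have : entry (ContinuousLinearMap.adjoint T) = adjointMatrix a := by
    funext m n
    ext y
    refine ext_inner_left ℂ fun x => ?_
    have h1 := lp.inner_single_left (𝕜 := ℂ) m x (ContinuousLinearMap.adjoint T (lp.single 2 n y))
    have h2 := lp.inner_single_right (𝕜 := ℂ) n y (T (lp.single 2 m x))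
    rw [hT.apply_single] at h2
    rw [ContinuousLinearMap.adjoint_inner_right] at h1
    rw [adjointMatrix, ContinuousLinearMap.adjoint_inner_right]
    exact h1.symm.trans h2
  rw [← this]
  exact represents_entry _

/-- If `T` is bounded below on `ℓ²`, then `1 - t T† T` is a strict contraction for small `t > 0`. -/
theorem norm_one_sub_smul_lt_one {T : Seq d X 2 →L[ℂ] Seq d Y 2} {κ : ℝ} (hκ : 0 < κ)
    (hT : ∀ x, κ * ‖x‖ ≤ ‖T x‖) {t : ℝ} (ht : 0 < t) (htT : t * ‖T‖ ^ 2 ≤ 1) :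
    ‖(1 : Seq d X 2 →L[ℂ] Seq d X 2) - (t : ℂ) • (ContinuousLinearMap.adjoint T ∘L T)‖ < 1 := by
  have hlt : Real.sqrt (1 - t * κ ^ 2) < 1 := by
    rw [Real.sqrt_lt' one_pos]
    have : 0 < t * κ ^ 2 := by positivity
    linarith
  refine lt_of_le_of_lt (ContinuousLinearMap.opNorm_le_bound _ (Real.sqrt_nonneg _) fun x => ?_) hlt
  set y := ContinuousLinearMap.adjoint T (T x) with hy
  have hxy : RCLike.re (inner ℂ x ((t : ℂ) • y)) = t * ‖T x‖ ^ 2 := by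
    rw [inner_smul_right, hy, ContinuousLinearMap.adjoint_inner_right, inner_self_eq_norm_sq_to_K]
    norm_cast
    change ((t : ℂ) * ((‖T x‖ ^ 2 : ℝ) : ℂ)).re = _
    rw [← Complex.ofReal_mul, Complex.ofReal_re]
  have hny : ‖y‖ ≤ ‖T‖ * ‖T x‖ := by
    have := (ContinuousLinearMap.adjoint T).le_opNorm (T x)
    rwa [LinearIsometryEquiv.norm_map] at this
  have hsq : ‖x - (t : ℂ) • y‖ ^ 2 ≤ (1 - t * κ ^ 2) * ‖x‖ ^ 2 := by
    rw [@norm_sub_sq ℂ, hxy, norm_smul, Complex.norm_real, Real.norm_of_nonneg ht.le]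
    have h1 : (t * ‖y‖) ^ 2 ≤ t * ‖T x‖ ^ 2 := by
      calc (t * ‖y‖) ^ 2 ≤ (t * (‖T‖ * ‖T x‖)) ^ 2 := by gcongr
        _ = t * ‖T x‖ ^ 2 * (t * ‖T‖ ^ 2) := by ring
        _ ≤ t * ‖T x‖ ^ 2 * 1 := by gcongr
        _ = _ := mul_one _
    have h2 : (κ * ‖x‖) ^ 2 ≤ ‖T x‖ ^ 2 := by
      gcongr
      exact hT x
    have h3 := mul_le_mul_of_nonneg_left h2 ht.le
    nlinarith
  change ‖x - (t : ℂ) • y‖ ≤ _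
  calc ‖x - (t : ℂ) • y‖ = Real.sqrt (‖x - (t : ℂ) • y‖ ^ 2) := (Real.sqrt_sq (norm_nonneg _)).symm
    _ ≤ Real.sqrt ((1 - t * κ ^ 2) * ‖x‖ ^ 2) := Real.sqrt_le_sqrt hsq
    _ = Real.sqrt (1 - t * κ ^ 2) * ‖x‖ := by
      rw [Real.sqrt_mul' _ (by positivity), Real.sqrt_sq (norm_nonneg _)]

/-- Inverse-closedness: if `T` is bounded below on `ℓ²` and `T† T` has finite weighted norm,
then so has the inverse of `T† T`. -/
theorem exists_inverse_adjoint_comp {s : ℝ} (hs : 1 ≤ s) {T : Seq d X 2 →L[ℂ] Seq d Y 2} {κ : ℝ}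
    (hκ : 0 < κ) (hT : ∀ x, κ * ‖x‖ ≤ ‖T x‖)
    (hfin : decayNorm s (ContinuousLinearMap.adjoint T ∘L T) ≠ ∞) :
    ∃ G : Seq d X 2 →L[ℂ] Seq d X 2, G * (ContinuousLinearMap.adjoint T ∘L T) = 1 ∧
      (ContinuousLinearMap.adjoint T ∘L T) * G = 1 ∧ decayNorm s G ≠ ∞ := by
  set M := ContinuousLinearMap.adjoint T ∘L T with hM
  set t : ℝ := (‖T‖ ^ 2 + 1)⁻¹ with ht
  have ht0 : 0 < t := by positivity
  have htT : t * ‖T‖ ^ 2 ≤ 1 := by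
    rw [ht, inv_mul_le_iff₀ (by positivity)]
    linarith
  obtain ⟨G, h1, h2, h3⟩ := exists_inverse_one_sub hs (norm_one_sub_smul_lt_one hκ hT ht0 htT)
    (ne_top_of_le_ne_top (ENNReal.add_ne_top.2 ⟨ne_top_of_le_ne_top ENNReal.one_ne_top
      (decayNorm_one_le s), ne_top_of_le_ne_top (ENNReal.mul_ne_top enorm_ne_top hfin)
      (decayNorm_smul_le s _ _)⟩) (decayNorm_sub_le s _ _))
  rw [sub_sub_cancel] at h1 h2
  refine ⟨(t : ℂ) • G, ?_, ?_, ne_top_of_le_ne_top (ENNReal.mul_ne_top enorm_ne_top h3)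
    (decayNorm_smul_le s _ _)⟩
  · rw [smul_mul_assoc, ← mul_smul_comm, h1]
  · rw [mul_smul_comm, ← smul_mul_assoc, h2]

end Hilbert

/-! ### Passing from `ℓ^p` to `ℓ²` -/

section Stability

theorem one_add_mul_pow_sub_one_le {ε z : ℝ} (h0 : 0 ≤ ε) (h1 : ε ≤ 1) (hz : 0 ≤ z) (t : ℕ) :
    (1 + ε * z) ^ t - 1 ≤ ε * ((1 + z) ^ t - 1) := by
  induction t with
  | zero => simp
  | succ t ih =>
    have hY : 1 ≤ (1 + z) ^ t := one_le_pow₀ (by linarith)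
    have h2 : 0 ≤ ε * z * ((1 + z) ^ t - 1) * (1 - ε) := by
      have := sub_nonneg.2 hY
      have := sub_nonneg.2 h1
      positivity
    have h3 := mul_le_mul_of_nonneg_right ih (show 0 ≤ 1 + ε * z by positivity)
    rw [pow_succ, pow_succ]
    nlinarith

variable {d : ℕ}

/-- A slowly varying bump at the origin, of width `ε⁻¹` and with decay of order `t`. -/
def bump (ε : ℝ) (t : ℕ) (j : Fin d → ℤ) : ℝ := ((1 + ε * ‖j‖) ^ t)⁻¹

theorem bump_pos {ε : ℝ} (h0 : 0 ≤ ε) (t : ℕ) (j : Fin d → ℤ) : 0 < bump ε t j := by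
  unfold bump
  positivity

@[simp] theorem bump_zero (ε : ℝ) (t : ℕ) : bump ε t (0 : Fin d → ℤ) = 1 := by simp [bump]

theorem bump_le_mul {ε : ℝ} (h0 : 0 ≤ ε) (t : ℕ) (i j : Fin d → ℤ) :
    bump ε t i ≤ (1 + ε * ‖i - j‖) ^ t * bump ε t j := by
  unfold bump
  rw [← div_eq_mul_inv, le_div_iff₀ (by positivity), inv_mul_le_iff₀ (by positivity), ← mul_pow]
  gcongr
  have h1 : ‖j‖ ≤ ‖i‖ + ‖i - j‖ := by
    simpa using norm_sub_le i (i - j)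
  have h2 := mul_le_mul_of_nonneg_left h1 h0
  have h3 : 0 ≤ ε * ‖i‖ * (ε * ‖i - j‖) := by positivity
  nlinarith

/-- The relative variation of the bump is of order `ε`, up to a polynomial factor. -/
theorem abs_one_sub_bump_div_le {ε : ℝ} (h0 : 0 ≤ ε) (h1 : ε ≤ 1) (t : ℕ) (i j : Fin d → ℤ) :
    |1 - bump ε t i / bump ε t j| ≤ ε * (1 + ‖i - j‖) ^ t := by
  set W := (1 + ε * ‖i - j‖) ^ t with hW
  have hW1 : 1 ≤ W := one_le_pow₀ (by have : 0 ≤ ε * ‖i - j‖ := by positivity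
                                      linarith)
  have hWle : W - 1 ≤ ε * (1 + ‖i - j‖) ^ t := by
    have := one_add_mul_pow_sub_one_le h0 h1 (norm_nonneg (i - j)) t
    linarith
  have hi := bump_pos h0 t i
  have hj := bump_pos h0 t j
  have h2 : bump ε t i / bump ε t j ≤ W := (div_le_iff₀ hj).2 (bump_le_mul h0 t i j)
  have h3 : W⁻¹ ≤ bump ε t i / bump ε t j := by
    rw [le_div_iff₀ hj, inv_mul_le_iff₀ (by linarith), hW, norm_sub_rev]
    exact bump_le_mul h0 t j i
  have h4 : 2 - W ≤ W⁻¹ := by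
    have h5 := mul_inv_cancel₀ (show W ≠ 0 by linarith)
    have h6 : 0 ≤ W⁻¹ := by positivity
    nlinarith [sq_nonneg (W - 1)]
  rw [abs_le]
  constructor <;> linarith

theorem tsum_bump_ne_top {ε : ℝ} (h0 : 0 < ε) (h1 : ε ≤ 1) {t : ℕ} (ht : d < t) :
    ∑' j : Fin d → ℤ, ENNReal.ofReal (bump ε t j) ≠ ∞ := by
  have hs : Summable fun j : Fin d → ℤ => bump ε t j := by
    refine Summable.of_nonneg_of_le (fun j => (bump_pos h0.le t j).le) (fun j => ?_)
      ((summable_one_add_norm_pow_inv (d := d) t ht).mul_left (ε ^ t)⁻¹)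
    rw [bump, ← mul_inv, ← mul_pow]
    gcongr
    have := norm_nonneg j
    nlinarith
  rw [← ENNReal.ofReal_tsum_of_nonneg (fun j => (bump_pos h0.le t j).le) hs]
  exact ENNReal.ofReal_ne_top

variable {X Y : Type*} [NormedAddCommGroup X] [NormedSpace ℂ X]
  [NormedAddCommGroup Y] [NormedSpace ℂ Y]

omit [NormedSpace ℂ Y] in
/-- The norm of `ℓ^p` is at most that of `ℓ¹`. -/
theorem enorm_le_tsum_enorm [CompleteSpace Y] {p : ℝ≥0∞} [hp : Fact (1 ≤ p)]
    (w : lp (fun _ : Fin d → ℤ => Y) p) :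
    ‖w‖ₑ ≤ ∑' m, ‖(w : (Fin d → ℤ) → Y) m‖ₑ := by
  by_cases h : ∑' m, ‖(w : (Fin d → ℤ) → Y) m‖ₑ = ∞
  · simp [h]
  have hsingle : ∀ m, ‖lp.single (E := fun _ : Fin d → ℤ => Y) p m
      ((w : (Fin d → ℤ) → Y) m)‖ₑ = ‖(w : (Fin d → ℤ) → Y) m‖ₑ := fun m => by
    rw [← ofReal_norm, ← ofReal_norm, lp.norm_single (zero_lt_one.trans_le hp.out)]
  have hs : Summable fun m => lp.single (E := fun _ : Fin d → ℤ => Y) p m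
      ((w : (Fin d → ℤ) → Y) m) := summable_of_tsum_enorm_ne_top (by simpa only [hsingle] using h)
  have hw : ∑' m, lp.single (E := fun _ : Fin d → ℤ => Y) p m ((w : (Fin d → ℤ) → Y) m) = w := by
    ext m
    have h1 := (hs.hasSum.map (lp.coeFnAddMonoidHom _ p) (by
      exact (lp.uniformContinuous_coe (p := p)).continuous)).map (Pi.evalAddMonoidHom _ m)
      (continuous_apply m)
    refine h1.unique ?_
    convert hasSum_single m fun k hk => ?_
    · simp
    · simp [hk.symm]
  calc ‖w‖ₑ = ‖∑' m, lp.single (E := fun _ : Fin d → ℤ => Y) p m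
        ((w : (Fin d → ℤ) → Y) m)‖ₑ := by rw [hw]
    _ ≤ _ := enorm_tsum_le_tsum_enorm.trans_eq (tsum_congr hsingle)

/-- The localized lower bound. Multiplication by the bump at `n` commutes with the matrix up to an
error that is small compared with the lower bound `κ` when `ε` is small. The lower bound in `ℓ^p`
therefore applies to the localized sequence, and it bounds `x n` by the values of `y = A x` near
the rows `m` with `φ m = n`. -/
theorem exists_local_bound [CompleteSpace Y] {φ : (Fin d → ℤ) → Fin d → ℤ} {K : ℕ}
    (hφ : FiberBound φ K) (hK : 1 ≤ K) {t : ℕ} {c : (Fin d → ℤ) → ℝ≥0∞}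
    (hc : ∑' j, c j * weight t j ≠ ∞) {a : OpMatrix d X Y}
    (ha : ∀ m n, ‖a m n‖ₑ ≤ c (φ m - n)) {p : ℝ≥0∞} [hp : Fact (1 ≤ p)]
    (hbb : IsBoundedBelow p a) :
    ∃ ε : ℝ, 0 < ε ∧ ε ≤ 1 ∧ ∃ B : ℝ, 0 ≤ B ∧ ∀ (x : (Fin d → ℤ) → X) (y : (Fin d → ℤ) → Y),
      {k | x k ≠ 0}.Finite → (∀ m, HasSum (fun k => a m k (x k)) (y m)) →
      ∀ n, ‖x n‖ₑ ≤ ENNReal.ofReal B * ∑' m, ENNReal.ofReal (bump ε t (φ m - n)) * ‖y m‖ₑ := by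
  obtain ⟨T, hT, κ, hκ, hTκ⟩ := hbb
  set S := (∑' j, c j * weight t j).toReal with hS
  have hS0 : 0 ≤ S := ENNReal.toReal_nonneg
  set ε := min 1 (κ / (2 * (S * K + 1))) with hε
  have hε0 : 0 < ε := lt_min one_pos (by positivity)
  have hε1 : ε ≤ 1 := min_le_left _ _
  have hεκ : ε * S * K ≤ κ / 2 := by
    have h1 : ε ≤ κ / (2 * (S * K + 1)) := min_le_right _ _
    rw [le_div_iff₀ (by positivity)] at h1
    nlinarith
  refine ⟨ε, hε0, hε1, 2 / κ, by positivity, fun x y hx hy n => ?_⟩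
  set u : (Fin d → ℤ) → ℝ := fun k => bump ε t (k - n) with hu
  have hu0 : ∀ k, 0 < u k := fun k => bump_pos hε0.le t _
  -- the localized sequence
  have hz : Memℓp (fun k => (u k : ℂ) • x k) p :=
    (memℓp_zero (hx.subset fun k hk => right_ne_zero_of_smul hk)).of_exponent_ge zero_le
  set z : Seq d X p := ⟨_, hz⟩ with hzdef
  -- the error matrix: the commutator, divided by the bump
  set e : OpMatrix d X Y := fun m k => ((1 - u (φ m) / u k : ℝ) : ℂ) • a m k with he
  have hee : ∀ m k, ‖e m k‖ₑ ≤ ENNReal.ofReal ε * (c (φ m - k) * weight t (φ m - k)) := by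
    intro m k
    have h1 : ‖((1 - u (φ m) / u k : ℝ) : ℂ)‖ₑ ≤ ENNReal.ofReal ε * weight t (φ m - k) := by
      rw [← ofReal_norm, Complex.norm_real, weight_natCast, ← ENNReal.ofReal_mul hε0.le]
      refine ENNReal.ofReal_le_ofReal ?_
      simpa using abs_one_sub_bump_div_le hε0.le hε1 t (φ m - n) (k - n)
    calc ‖e m k‖ₑ = ‖((1 - u (φ m) / u k : ℝ) : ℂ)‖ₑ * ‖a m k‖ₑ := enorm_smul _ _
      _ ≤ (ENNReal.ofReal ε * weight t (φ m - k)) * c (φ m - k) := mul_le_mul' h1 (ha m k)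
      _ = _ := by ring
  have hesum : ∑' j, ENNReal.ofReal ε * (c j * weight t j) ≠ ∞ := by
    rw [ENNReal.tsum_mul_left]
    exact ENNReal.mul_ne_top ENNReal.ofReal_ne_top hc
  obtain ⟨E, hE, hEn⟩ := exists_represents p hφ hK hesum hee
  rw [ENNReal.tsum_mul_left, ENNReal.toReal_mul, ENNReal.toReal_ofReal hε0.le, ← hS] at hEn
  have hdiff : ∀ m, ((T z - E z : Seq d Y p) : (Fin d → ℤ) → Y) m = (u (φ m) : ℂ) • y m := by
    intro m
    refine ((hT z m).sub (hE z m)).unique ?_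
    convert (hy m).const_smul (u (φ m) : ℂ) using 2 with k
    have huk : (u k : ℂ) ≠ 0 := by exact_mod_cast (hu0 k).ne'
    simp only [hzdef, he, smul_apply, map_smul, smul_smul, ← sub_smul]
    congr 1
    push_cast
    field_simp
    ring
  have hlow : ‖x n‖ ≤ 2 / κ * ‖T z - E z‖ := by
    have h1 : ‖x n‖ ≤ ‖z‖ := by
      refine le_trans (le_of_eq ?_) (lp.norm_apply_le_norm ne_zero_of_fact z n)
      simp [hzdef, hu]
    have h2 : ‖E z‖ ≤ κ / 2 * ‖z‖ := E.le_of_opNorm_le (hEn.trans hεκ) z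
    have h3 := norm_sub_norm_le (T z) (E z)
    have h4 := hTκ z
    rw [div_mul_eq_mul_div, le_div_iff₀ hκ]
    nlinarith
  calc ‖x n‖ₑ ≤ ENNReal.ofReal (2 / κ) * ‖T z - E z‖ₑ := by
        rw [← ofReal_norm, ← ofReal_norm, ← ENNReal.ofReal_mul (by positivity)]
        exact ENNReal.ofReal_le_ofReal hlow
    _ ≤ ENNReal.ofReal (2 / κ) * ∑' m, ENNReal.ofReal (bump ε t (φ m - n)) * ‖y m‖ₑ := by
        gcongr
        refine (enorm_le_tsum_enorm _).trans_eq (tsum_congr fun m => ?_)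
        rw [hdiff, enorm_smul, ← ofReal_norm, Complex.norm_real,
          Real.norm_of_nonneg (hu0 _).le]

/-- The operator on scalar `ℓ²` sequences that sums against the bumps: it turns the localized
bounds into a bound in `ℓ²`. -/
theorem exists_bump_operator {α : ℝ} (hα : α ≠ 0) {ε : ℝ} (h0 : 0 < ε) (h1 : ε ≤ 1) {t : ℕ}
    (ht : d < t) :
    ∃ V : Seq d ℂ 2 →L[ℂ] Seq d ℂ 2, ∀ (v : Seq d ℂ 2) (n : Fin d → ℤ),
      HasSum (fun m => (bump ε t (slantIndex α m - n) : ℂ) * (v : (Fin d → ℤ) → ℂ) m)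
        ((V v : (Fin d → ℤ) → ℂ) n) := by
  let b : OpMatrix d ℂ ℂ := fun n m =>
    (bump ε t (slantIndex α m - n) : ℂ) • ContinuousLinearMap.id ℂ ℂ
  have hb : SummableSlants α⁻¹ (polyWeight d 0) b := by
    refine summableSlants_inv_of_transposed hα le_rfl (c := fun j => ENNReal.ofReal (bump ε t j))
      (by simpa using tsum_bump_ne_top h0 h1 ht) fun n m => ?_
    rw [enorm_smul, ← ofReal_norm, Complex.norm_real, Real.norm_of_nonneg (bump_pos h0.le _ _).le]
    refine mul_le_of_le_one_right' ?_
    rw [← ofReal_norm, ← ENNReal.ofReal_one]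
    exact ENNReal.ofReal_le_ofReal ContinuousLinearMap.norm_id_le
  obtain ⟨c, hc, hfin⟩ := (summableSlants_iff (inv_ne_zero hα) 0 b).1 hb
  obtain ⟨K, hK⟩ := exists_fiberBound_slantIndex (d := d) (inv_ne_zero hα)
  obtain ⟨V, hV, -⟩ := exists_represents 2 (K := K + 1) (fun F n h => (hK F n h).trans K.le_succ)
    (Nat.succ_pos K) (tsum_ne_top_of_weight le_rfl hfin) hc
  exact ⟨V, fun v n => by simpa [b] using hV v n⟩

/-- Stability in `p`: a slanted matrix with enough decay that is bounded below in some `ℓ^p` is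
bounded below in `ℓ²`. -/
theorem exists_lower_bound_two [CompleteSpace Y] {α : ℝ} (hα : α ≠ 0) {t : ℕ} (ht : d < t)
    {a : OpMatrix d X Y} (ha : SummableSlants α (polyWeight d t) a) {p : ℝ≥0∞} [Fact (1 ≤ p)]
    (hbb : IsBoundedBelow p a) {T : Seq d X 2 →L[ℂ] Seq d Y 2} (hT : Represents a T) :
    ∃ κ : ℝ, 0 < κ ∧ ∀ x, κ * ‖x‖ ≤ ‖T x‖ := by
  obtain ⟨c, hc, hfin⟩ := (summableSlants_iff hα t a).1 ha
  obtain ⟨K, hK⟩ := exists_fiberBound_slantIndex (d := d) hα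
  obtain ⟨ε, hε0, hε1, B, hB, hloc⟩ := exists_local_bound (K := K + 1)
    (fun F n h => (hK F n h).trans K.le_succ) (Nat.succ_pos K) hfin hc hbb
  obtain ⟨V, hV⟩ := exists_bump_operator (d := d) hα hε0 hε1 ht
  -- the bound for finitely supported sequences
  have hbound : ∀ x : Seq d X 2, {k | (x : (Fin d → ℤ) → X) k ≠ 0}.Finite →
      ‖x‖ ≤ B * ‖V‖ * ‖T x‖ := by
    intro x hx
    obtain ⟨hy, hyn⟩ := FiberBound.id.memℓp le_rfl zero_le_one (T x)
      (f := fun m => ((‖(T x : (Fin d → ℤ) → Y) m‖ : ℝ) : ℂ)) fun m => by simp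
    set y : Seq d ℂ 2 := ⟨_, hy⟩ with hydef
    have hxn : ∀ n, ‖(x : (Fin d → ℤ) → X) n‖ ≤ B * ‖(V y : (Fin d → ℤ) → ℂ) n‖ := by
      intro n
      have h1 := hV y n
      have h2 : HasSum (fun m => ((bump ε t (slantIndex α m - n) *
          ‖(T x : (Fin d → ℤ) → Y) m‖ : ℝ) : ℂ)) ((V y : (Fin d → ℤ) → ℂ) n) := by
        convert h1 using 2 with m
        simp [hydef]
      have hnn : ∀ m, 0 ≤ bump ε t (slantIndex α m - n) * ‖(T x : (Fin d → ℤ) → Y) m‖ :=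
        fun m => mul_nonneg (bump_pos hε0.le _ _).le (norm_nonneg _)
      have h3 := Complex.summable_ofReal.1 h2.summable
      have h4 := hloc x (T x) hx (hT x) n
      rw [← h2.tsum_eq, ← Complex.ofReal_tsum, Complex.norm_real,
        Real.norm_of_nonneg (tsum_nonneg hnn), ← ENNReal.ofReal_le_ofReal_iff
        (mul_nonneg hB (tsum_nonneg hnn)), ENNReal.ofReal_mul hB,
        ENNReal.ofReal_tsum_of_nonneg hnn h3, ofReal_norm]
      refine h4.trans_eq ?_
      congr 1
      refine tsum_congr fun m => ?_
      rw [ENNReal.ofReal_mul (bump_pos hε0.le _ _).le, ofReal_norm]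
    obtain ⟨hx', hxn'⟩ := FiberBound.id.memℓp le_rfl hB (V y) hxn
    calc ‖x‖ ≤ B * (1 : ℕ) * ‖V y‖ := hxn'
      _ ≤ B * (1 : ℕ) * (‖V‖ * (1 * (1 : ℕ) * ‖T x‖)) := by
          gcongr
          exact (V.le_opNorm y).trans (by gcongr)
      _ = B * ‖V‖ * ‖T x‖ := by push_cast; ring
  -- finitely supported sequences are dense
  have hall : ∀ x : Seq d X 2, ‖x‖ ≤ B * ‖V‖ * ‖T x‖ := by
    intro x
    have hlim := lp.hasSum_single (p := 2) ENNReal.ofNat_ne_top x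
    refine le_of_tendsto_of_tendsto' hlim.norm
      (((T.continuous.tendsto x).comp hlim).norm.const_mul _) fun F => hbound _ ?_
    refine F.finite_toSet.subset fun k hk => ?_
    by_contra hkF
    refine hk ?_
    rw [lp.coeFn_sum, Finset.sum_apply]
    refine Finset.sum_eq_zero fun i hi => ?_
    exact lp.single_apply_ne (E := fun _ : Fin d → ℤ => X) 2 i _ fun h => hkF (h ▸ hi)
  refine ⟨(B * ‖V‖ + 1)⁻¹, by positivity, fun x => ?_⟩
  rw [inv_mul_le_iff₀ (by positivity)]
  have := hall x
  have := norm_nonneg (T x)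
  linarith

end Stability

/-! ### The Gram matrix and its inverse -/

section Gram

variable {d : ℕ} {X Y : Type*} [NormedAddCommGroup X] [InnerProductSpace ℂ X] [CompleteSpace X]
  [NormedAddCommGroup Y] [InnerProductSpace ℂ Y] [CompleteSpace Y]

theorem enorm_adjointMatrix (a : OpMatrix d X Y) (n m : Fin d → ℤ) :
    ‖adjointMatrix a n m‖ₑ = ‖a m n‖ₑ := by
  rw [adjointMatrix, ← ofReal_norm, ← ofReal_norm, LinearIsometryEquiv.norm_map]

@[simp] theorem adjointMatrix_adjointMatrix (a : OpMatrix d X Y) :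
    adjointMatrix (adjointMatrix a) = a := by
  funext m n
  simp [adjointMatrix]

theorem SummableSlants.adjoint {α : ℝ} (hα : α ≠ 0) {s : ℝ} (hs : 0 ≤ s)
    {a : OpMatrix d X Y} (ha : SummableSlants α (polyWeight d s) a) :
    SummableSlants α⁻¹ (polyWeight d s) (adjointMatrix a) := by
  obtain ⟨c, hc, hfin⟩ := (summableSlants_iff hα s a).1 ha
  exact summableSlants_inv_of_transposed hα hs hfin fun n m =>
    (enorm_adjointMatrix a n m).trans_le (hc m n)

omit [CompleteSpace X] [CompleteSpace Y] in
theorem SummableSlants.mono {α : ℝ} (hα : α ≠ 0) {s t : ℝ} (h : t ≤ s) {a : OpMatrix d X Y}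
    (ha : SummableSlants α (polyWeight d s) a) : SummableSlants α (polyWeight d t) a := by
  obtain ⟨c, hc, hfin⟩ := (summableSlants_iff hα s a).1 ha
  refine (summableSlants_iff hα t a).2 ⟨c, hc, ne_top_of_le_ne_top hfin ?_⟩
  gcongr
  exact weight_mono_exponent h _

omit [CompleteSpace X] [CompleteSpace Y] in
theorem SummableSlants.rowBounded {α : ℝ} (hα : α ≠ 0) {s : ℝ} (hs : 0 ≤ s) {a : OpMatrix d X Y}
    (ha : SummableSlants α (polyWeight d s) a) : RowBounded a := by
  obtain ⟨c, hc, hfin⟩ := (summableSlants_iff hα s a).1 ha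
  exact rowBounded_of_envelope (tsum_ne_top_of_weight hs hfin) hc

omit [CompleteSpace X] in
theorem SummableSlants.exists_represents {α : ℝ} (hα : α ≠ 0) {s : ℝ} (hs : 0 ≤ s)
    {a : OpMatrix d X Y} (ha : SummableSlants α (polyWeight d s) a) (q : ℝ≥0∞) [Fact (1 ≤ q)] :
    ∃ T : Seq d X q →L[ℂ] Seq d Y q, Represents a T := by
  obtain ⟨c, hc, hfin⟩ := (summableSlants_iff hα s a).1 ha
  obtain ⟨K, hK⟩ := exists_fiberBound_slantIndex (d := d) hα
  obtain ⟨T, hT, -⟩ := Slanted.exists_represents q (K := K + 1)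
    (fun F n h => (hK F n h).trans K.le_succ) (Nat.succ_pos K) (tsum_ne_top_of_weight hs hfin) hc
  exact ⟨T, hT⟩

/-- The Gram matrix of a slanted matrix decays away from the diagonal, with the same weight. -/
theorem exists_gram_envelope {α : ℝ} (hα : α ≠ 0) {s : ℝ} (hs : 0 ≤ s) {a : OpMatrix d X Y}
    (ha : SummableSlants α (polyWeight d s) a) :
    ∃ e : (Fin d → ℤ) → ℝ≥0∞, ∑' j, e j * weight s j ≠ ∞ ∧
      ∀ m n, ‖mulMatrix (adjointMatrix a) a m n‖ₑ ≤ e (m - n) := by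
  obtain ⟨c, hc, hfin⟩ := (summableSlants_iff hα s a).1 ha
  obtain ⟨K, hK⟩ := exists_fiberBound_slantIndex (d := d) hα
  have hfin' : ∑' j, c (-j) * weight s j ≠ ∞ := by
    rw [← (Equiv.neg (Fin d → ℤ)).tsum_eq] at hfin
    simpa using hfin
  refine ⟨fun j => K * ∑' i, c (-i) * c (j - i), ?_, fun m n => ?_⟩
  · simp_rw [mul_assoc, ENNReal.tsum_mul_left]
    exact ENNReal.mul_ne_top (ENNReal.natCast_ne_top K) (ne_top_of_le_ne_top
      (ENNReal.mul_ne_top hfin' hfin) (tsum_conv_mul_weight_le hs (fun i => c (-i)) c))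
  · calc ‖mulMatrix (adjointMatrix a) a m n‖ₑ
        ≤ ∑' k, ‖adjointMatrix a m k‖ₑ * ‖a k n‖ₑ := enorm_mulMatrix_le _ _ m n
      _ ≤ ∑' k, c (slantIndex α k - m) * c (slantIndex α k - n) := by
          refine ENNReal.tsum_le_tsum fun k => mul_le_mul' ?_ (hc k n)
          rw [enorm_adjointMatrix]
          exact hc k m
      _ ≤ K * ∑' l, c (l - m) * c (l - n) := hK.tsum_comp_le fun l => c (l - m) * c (l - n)
      _ = K * ∑' i, c (-i) * c (m - n - i) := by
          rw [← (Equiv.subLeft m).tsum_eq]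
          congr 1
          refine tsum_congr fun i => ?_
          simp only [Equiv.subLeft_apply]
          congr 2 <;> abel

/-- If a slanted matrix is bounded below in some `ℓ^p`, then its Gram matrix has an inverse matrix,
with the same off-diagonal decay. -/
theorem exists_gram_inverse {α : ℝ} (hα : α ≠ 0) {s : ℝ} (hs : (d : ℝ) + 1 ≤ s)
    {a : OpMatrix d X Y} (ha : SummableSlants α (polyWeight d s) a) {p : ℝ≥0∞} [Fact (1 ≤ p)]
    (hbb : IsBoundedBelow p a) :
    ∃ (G : OpMatrix d X X) (g : (Fin d → ℤ) → ℝ≥0∞), ∑' j, g j * weight s j ≠ ∞ ∧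
      (∀ m n, ‖G m n‖ₑ ≤ g (m - n)) ∧
      mulMatrix G (mulMatrix (adjointMatrix a) a) = oneMatrix d X ∧
      mulMatrix (mulMatrix (adjointMatrix a) a) G = oneMatrix d X := by
  have hd0 : (0 : ℝ) ≤ d := Nat.cast_nonneg d
  have hs1 : 1 ≤ s := by linarith
  have hs0 : 0 ≤ s := by linarith
  obtain ⟨T, hT⟩ := ha.exists_represents hα hs0 2
  obtain ⟨κ, hκ, hTκ⟩ := exists_lower_bound_two hα d.lt_succ_self
    (ha.mono hα (t := (d.succ : ℕ)) (by push_cast; exact hs)) hbb hT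
  obtain ⟨e, he, hae⟩ := exists_gram_envelope hα hs0 ha
  have hrow := rowBounded_of_envelope (φ := fun m => m) (tsum_ne_top_of_weight hs0 he) hae
  have hM : Represents (mulMatrix (adjointMatrix a) a) (ContinuousLinearMap.adjoint T ∘L T) :=
    (represents_adjoint hT).mul ((ha.adjoint hα hs0).rowBounded (inv_ne_zero hα) hs0)
      (ha.rowBounded hα hs0) hT
  obtain ⟨G, h1, h2, h3⟩ := exists_inverse_adjoint_comp hs1 hκ hTκ (by
    refine ne_top_of_le_ne_top he (decayNorm_le fun m n => ?_)
    rw [(represents_entry _).matrix_unique hM]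
    exact hae m n)
  have hGrow : RowBounded (entry G) := rowBounded_of_envelope (φ := fun m => m)
    (tsum_ne_top_of_weight hs0 h3) (enorm_entry_le_offDiag G)
  refine ⟨entry G, offDiag G, h3, enorm_entry_le_offDiag G, ?_, ?_⟩
  · have := (represents_entry G).mul hGrow hrow hM
    rw [show G ∘L (ContinuousLinearMap.adjoint T ∘L T) = ContinuousLinearMap.id ℂ _ from h1] at this
    exact this.matrix_unique (represents_one 2)
  · have := hM.mul hrow hGrow (represents_entry G)
    rw [show (ContinuousLinearMap.adjoint T ∘L T) ∘L G = ContinuousLinearMap.id ℂ _ from h2] at this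
    exact this.matrix_unique (represents_one 2)

/-- The inverse of the Gram matrix inverts the Gram operator on every `ℓ^q`, since products of
matrices represent compositions. -/
theorem exists_gram_operators {α : ℝ} (hα : α ≠ 0) {s : ℝ} (hs : 0 ≤ s)
    {a : OpMatrix d X Y} (ha : SummableSlants α (polyWeight d s) a)
    {G : OpMatrix d X X} {g : (Fin d → ℤ) → ℝ≥0∞} (hg : ∑' j, g j * weight s j ≠ ∞)
    (hG : ∀ m n, ‖G m n‖ₑ ≤ g (m - n))
    (h1 : mulMatrix G (mulMatrix (adjointMatrix a) a) = oneMatrix d X)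
    (h2 : mulMatrix (mulMatrix (adjointMatrix a) a) G = oneMatrix d X)
    (q : ℝ≥0∞) [Fact (1 ≤ q)] :
    ∃ (T : Seq d X q →L[ℂ] Seq d Y q) (T' : Seq d Y q →L[ℂ] Seq d X q)
      (U : Seq d X q →L[ℂ] Seq d X q), Represents a T ∧ Represents (adjointMatrix a) T' ∧
      Represents G U ∧ U * (T' ∘L T) = 1 ∧ (T' ∘L T) * U = 1 := by
  obtain ⟨T, hT⟩ := ha.exists_represents hα hs q
  have ha' := ha.adjoint hα hs
  obtain ⟨T', hT'⟩ := ha'.exists_represents (inv_ne_zero hα) hs q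
  obtain ⟨U, hU, -⟩ := exists_represents q FiberBound.id le_rfl (tsum_ne_top_of_weight hs hg) hG
  obtain ⟨e, he, hae⟩ := exists_gram_envelope hα hs ha
  have hM := hT'.mul (ha'.rowBounded (inv_ne_zero hα) hs) (ha.rowBounded hα hs) hT
  have hMrow := rowBounded_of_envelope (φ := fun m => m) (tsum_ne_top_of_weight hs he) hae
  have hGrow := rowBounded_of_envelope (φ := fun m => m) (tsum_ne_top_of_weight hs hg) hG
  refine ⟨T, T', U, hT, hT', hU, ?_, ?_⟩
  · have := hU.mul hGrow hMrow hM
    rw [h1] at this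
    exact this.unique (represents_one q)
  · have := hM.mul hMrow hGrow hU
    rw [h2] at this
    exact this.unique (represents_one q)

omit [CompleteSpace X] [CompleteSpace Y] in
theorem SummableSlants.mul_right {α : ℝ} (hα : α ≠ 0) {s : ℝ} (hs : 0 ≤ s) {a : OpMatrix d X Y}
    (ha : SummableSlants α (polyWeight d s) a) {G : OpMatrix d X X} {g : (Fin d → ℤ) → ℝ≥0∞}
    (hg : ∑' j, g j * weight s j ≠ ∞) (hG : ∀ m n, ‖G m n‖ₑ ≤ g (m - n)) :
    SummableSlants α (polyWeight d s) (mulMatrix a G) := by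
  obtain ⟨c, hc, hfin⟩ := (summableSlants_iff hα s a).1 ha
  refine (summableSlants_iff hα s _).2 ⟨fun j => ∑' i, c i * g (j - i), fun m n => ?_,
    ne_top_of_le_ne_top (ENNReal.mul_ne_top hfin hg) (tsum_conv_mul_weight_le hs c g)⟩
  beta_reduce
  rw [← (Equiv.subLeft (slantIndex α m)).tsum_eq]
  refine (enorm_mulMatrix_le a G m n).trans (ENNReal.tsum_le_tsum fun k => ?_)
  refine mul_le_mul' (hc m k) ((hG k n).trans_eq (congrArg g ?_))
  simp only [Equiv.subLeft_apply]
  abel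

theorem SummableSlants.mul_adjointMatrix {α : ℝ} (hα : α ≠ 0) {s : ℝ} (hs : 0 ≤ s)
    {a : OpMatrix d X Y} (ha : SummableSlants α (polyWeight d s) a) {G : OpMatrix d X X}
    {g : (Fin d → ℤ) → ℝ≥0∞} (hg : ∑' j, g j * weight s j ≠ ∞)
    (hG : ∀ m n, ‖G m n‖ₑ ≤ g (m - n)) :
    SummableSlants α⁻¹ (polyWeight d s) (mulMatrix G (adjointMatrix a)) := by
  obtain ⟨c, hc, hfin⟩ := (summableSlants_iff hα s a).1 ha
  have hg' : ∑' j, g (-j) * weight s j ≠ ∞ := by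
    rw [← (Equiv.neg (Fin d → ℤ)).tsum_eq] at hg
    simpa using hg
  refine summableSlants_inv_of_transposed hα hs (c := fun j => ∑' i, c i * g (-(j - i)))
    (ne_top_of_le_ne_top (ENNReal.mul_ne_top hfin hg')
      (tsum_conv_mul_weight_le hs c fun j => g (-j))) fun n m => ?_
  rw [← (Equiv.subLeft (slantIndex α m)).tsum_eq]
  refine (enorm_mulMatrix_le G _ n m).trans (ENNReal.tsum_le_tsum fun k => ?_)
  rw [mul_comm, enorm_adjointMatrix]
  refine mul_le_mul' (hc m k) ((hG n k).trans_eq (congrArg g ?_))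
  simp only [Equiv.subLeft_apply]
  abel

theorem ring_inverse_eq_of_mul_eq_one {M : Type*} [MonoidWithZero M] {a b : M} (h1 : a * b = 1)
    (h2 : b * a = 1) : IsUnit a ∧ Ring.inverse a = b :=
  ⟨⟨⟨a, b, h1, h2⟩, rfl⟩, Ring.inverse_unit ⟨a, b, h1, h2⟩⟩

end Gram

end Slanted

end

theorem mainTheorem2 {X Y : Type*}
    [NormedAddCommGroup X] [InnerProductSpace ℂ X] [CompleteSpace X]
    [NormedAddCommGroup Y] [InnerProductSpace ℂ Y] [CompleteSpace Y]
    (d : ℕ) (hd : 1 ≤ d) (α : ℝ) (hα : α ≠ 0) (s : ℝ) (hs : ((d : ℝ) + 1) ^ 2 < s)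
    (A : Slanted.OpMatrix d X Y) (hA : Slanted.SummableSlants α (Slanted.polyWeight d s) A)
    (p : ℝ≥0∞) [Fact (1 ≤ p)] :
    (Slanted.IsBoundedBelow p A →
      ∃ S : Slanted.OpMatrix d Y X,
        Slanted.SummableSlants α⁻¹ (Slanted.polyWeight d s) S ∧
        ∀ (q : ℝ≥0∞) [Fact (1 ≤ q)],
          ∃ (T : Slanted.Seq d X q →L[ℂ] Slanted.Seq d Y q)
            (T' R : Slanted.Seq d Y q →L[ℂ] Slanted.Seq d X q),
            Slanted.Represents A T ∧ Slanted.Represents (Slanted.adjointMatrix A) T' ∧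
            Slanted.Represents S R ∧
            IsUnit (T' ∘L T) ∧ R = Ring.inverse (T' ∘L T) ∘L T' ∧
            R ∘L T = ContinuousLinearMap.id ℂ (Slanted.Seq d X q)) ∧
    (Slanted.IsBoundedBelow p (Slanted.adjointMatrix A) →
      ∃ S : Slanted.OpMatrix d Y X,
        Slanted.SummableSlants α⁻¹ (Slanted.polyWeight d s) S ∧
        ∀ (q : ℝ≥0∞) [Fact (1 ≤ q)],
          ∃ (T : Slanted.Seq d X q →L[ℂ] Slanted.Seq d Y q)
            (T' R : Slanted.Seq d Y q →L[ℂ] Slanted.Seq d X q),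
            Slanted.Represents A T ∧ Slanted.Represents (Slanted.adjointMatrix A) T' ∧
            Slanted.Represents S R ∧
            IsUnit (T ∘L T') ∧ R = T' ∘L Ring.inverse (T ∘L T') ∧
            T ∘L R = ContinuousLinearMap.id ℂ (Slanted.Seq d Y q)) := by
  have hd0 : (0 : ℝ) ≤ d := Nat.cast_nonneg d
  have hs' : (d : ℝ) + 1 ≤ s := by nlinarith
  have hs0 : 0 ≤ s := by linarith
  have hA' := hA.adjoint hα hs0
  constructor
  · intro hbb
    obtain ⟨G, g, hg, hG, h1, h2⟩ := Slanted.exists_gram_inverse hα hs' hA hbb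
    refine ⟨_, hA.mul_adjointMatrix hα hs0 hg hG, fun q _ => ?_⟩
    obtain ⟨T, T', U, hT, hT', hU, hU1, hU2⟩ :=
      Slanted.exists_gram_operators hα hs0 hA hg hG h1 h2 q
    obtain ⟨hunit, hinv⟩ := Slanted.ring_inverse_eq_of_mul_eq_one hU2 hU1
    have hGrow := Slanted.rowBounded_of_envelope (φ := fun m => m)
      (Slanted.tsum_ne_top_of_weight hs0 hg) hG
    refine ⟨T, T', U ∘L T', hT, hT', hU.mul hGrow (hA'.rowBounded (inv_ne_zero hα) hs0) hT',
      hunit, by rw [hinv], hU1⟩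
  · intro hbb
    obtain ⟨G, g, hg, hG, h1, h2⟩ := Slanted.exists_gram_inverse (inv_ne_zero hα) hs' hA' hbb
    refine ⟨_, hA'.mul_right (inv_ne_zero hα) hs0 hg hG, fun q _ => ?_⟩
    obtain ⟨T', T, U, hT', hT, hU, hU1, hU2⟩ :=
      Slanted.exists_gram_operators (inv_ne_zero hα) hs0 hA' hg hG h1 h2 q
    rw [Slanted.adjointMatrix_adjointMatrix] at hT
    obtain ⟨hunit, hinv⟩ := Slanted.ring_inverse_eq_of_mul_eq_one hU2 hU1
    have hGrow := Slanted.rowBounded_of_envelope (φ := fun m => m)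
      (Slanted.tsum_ne_top_of_weight hs0 hg) hG
    refine ⟨T, T', T' ∘L U, hT, hT', hT'.mul (hA'.rowBounded (inv_ne_zero hα) hs0) hGrow hU,
      hunit, by rw [hinv], hU2⟩
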